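/- Conventions. A Hilbert $\mathbb H$-space $\mathfrak H$ is a real Hilbert space that is also a left and a right $\mathbb H$-vector space (real quaternions acting as real scalars) with $\langle qx,y\rangle=\langle x,q^*y\rangle$ and $\langle xq,y\rangle=\langle x,yq^*\rangle$ for all $x,y\in\mathfrak H$, $q\in\mathbb H$. Inner products are linear in the first variable. $\mathcal B^{r}(\mathfrak H)$ is the real algebra of bounded $\mathbb R$-linear operators $T$ on $\mathfrak H$ with $T(xq)=T(x)q$. Let $\mathfrak H_{\mathbb C}=\mathfrak H+i\mathfrak H$ be the complexification with its natural inner product, $C(x+iy)=x-iy$, $T_{\mathbb C}(x+iy)=Tx+iTy$, $S^\flat=CSC$ for a bounded complex operator $S$ on $\mathfrak H_{\mathbb C}$, and $(x+iy)q=xq+i\,yq$. For a bounded operator $T$ on a real normed space, $\sigma_{\mathbb C}(T)=\{u+iv:\ u,v\in\mathbb R,\ (u-T)^2+v^2 \text{ is not invertible}\}$. A spectral measure on a $\sigma$-algebra $\Sigma$ of subsets of a set $\mathfrak S$ is a map $F$ from $\Sigma$ to the self-adjoint projections of a (real or complex) Hilbert space with $F(\emptyset)=0$, $F(\mathfrak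 S)=1$, $F(A\cap B)=F(A)F(B)$, and $A\mapsto\langle F(A)x,y\rangle$ countably additive for all $x,y$. Theorem. Let $T\in\mathcal B^{r}(\mathfrak H)$ be normal and $\mathfrak S=\sigma(T_{\mathbb C})$. There is exactly one spectral measure $E_{\mathbb C}$ on $\mathrm{Bor}(\mathfrak S)$, with values in the bounded operators on $\mathfrak H_{\mathbb C}$, such that $T_{\mathbb C}=\int_{\mathfrak S}z\,dE_{\mathbb C}(z)$, i.e. $\langle T_{\mathbb C}\xi,\eta\rangle=\int_{\mathfrak S} z\,d\langle E_{\mathbb C}(\cdot)\xi,\eta\rangle$ for all $\xi,\eta\in\mathfrak H_{\mathbb C}$. Its values are right $\mathbb H$-linear. Let $A^c=\{\bar z:z\in A\}$ and let $\mathrm{Bor}_{E_{\mathbb C}}(\mathfrak S)$ be the $\sigma$-algebra of the Borel sets $A\subset\mathfrak S$ with $E_{\mathbb C}(A)=E_{\mathbb C}(A^c)$; for Borel $A$ this condition is equivalent to $E_{\mathbb C}(A)^\flat=E_{\mathbb C}(A)$. Then $E_{\mathbb R}(A)=E_{\mathbb C}(A)|_{\mathfrak H}$, $A\in\mathrm{Bor}_{E_{\mathbb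 C}}(\mathfrak S)$, defines a real spectral measure with values in $\mathcal B^{r}(\mathfrak H)$. For $x,y\in\mathfrak H$ let $\mu_{x,y}$ be the complex Borel measure $\mu_{x,y}(A)=\langle E_{\mathbb C}(A)x,y\rangle$ on $\mathfrak S$, which extends $A\mapsto\langle E_{\mathbb R}(A)x,y\rangle$, $A\in\mathrm{Bor}_{E_{\mathbb C}}(\mathfrak S)$. Let $L^\infty_s(\mathfrak S)$ be the real algebra of the Borel functions $f:\mathfrak S\to\mathbb C$ that satisfy $f(\bar z)=\overline{f(z)}$ outside an $E_{\mathbb C}$-null set and $\|f\|_\infty=\inf\{r>0: E_{\mathbb C}(\{|f|\ge r\})=0\}<\infty$, modulo those with $\|f\|_\infty=0$. Then every such $f$ is $\mu_{x,y}$-integrable, and the formula $$\langle\Phi(f)x,y\rangle=\int_{\mathfrak S}f\,d\mu_{x,y},\qquad f\in L^\infty_s(\mathfrak S),\ x,y\in\mathfrak H,$$ defines a unital isometric (in particular injective) morphism of real algebras $\Phi:L^\infty_s(\mathfrak S)\to\mathcal B^{r}(\mathfrak H)$. Moreover: (i) $\Phi(p)=p(T)$ for every polynomial $p$ with real coefficients;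 (ii) $\Phi(f)$ is normal and $\Phi(\bar f)=\Phi(f)^*$ for all $f\in L^\infty_s(\mathfrak S)$; (iii) $\|\Phi(f)x\|^2=\int_{\mathfrak S}|f|^2\,d\mu_{x,x}$ for all $f\in L^\infty_s(\mathfrak S)$, $x\in\mathfrak H$; (iv) for all $A\in\mathrm{Bor}_{E_{\mathbb C}}(\mathfrak S)$, the space $E_{\mathbb R}(A)\mathfrak H$ is invariant under $T$ and $\sigma_{\mathbb C}(T|_{E_{\mathbb R}(A)\mathfrak H})\subset\overline{A}$ (closure in $\mathbb C$); (v) if $S$ is a bounded $\mathbb R$-linear operator on $\mathfrak H$ (in particular, if $S\in\mathcal B^{r}(\mathfrak H)$) and $ST=TS$, then $SE_{\mathbb R}(A)=E_{\mathbb R}(A)S$ for all $A\in\mathrm{Bor}_{E_{\mathbb C}}(\mathfrak S)$. -/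

import Mathlib

open MeasureTheory Function
open scoped Quaternion ComplexConjugate

noncomputable section

/-! ## The complexification of a real Hilbert space -/

/-- The complexification `H + iH` of a real Hilbert space `H`; `x + iy` is stored as the pair
`(x, y)`, with the `ℓ²` norm `‖x + iy‖² = ‖x‖² + ‖y‖²`. -/
def Cplx (H : Type*) : Type _ := WithLp 2 (H × H)

namespace Cplx

section Basic

variable {H : Type*}

/-- The element `x + iy`. -/
def mk (x y : H) : Cplx H := WithLp.toLp 2 (x, y)

/-- The real part `x` of `x + iy`. -/
def re (ξ : Cplx H) : H := WithLp.fst (p := 2) (α := H) (β := H) ξ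

/-- The imaginary part `y` of `x + iy`. -/
def im (ξ : Cplx H) : H := WithLp.snd (p := 2) (α := H) (β := H) ξ

@[simp] theorem re_mk (x y : H) : (mk x y).re = x := rfl

@[simp] theorem im_mk (x y : H) : (mk x y).im = y := rfl

@[ext] theorem ext {ξ η : Cplx H} (h₁ : ξ.re = η.re) (h₂ : ξ.im = η.im) : ξ = η := by
  have : (ξ : WithLp 2 (H × H)).ofLp = (η : WithLp 2 (H × H)).ofLp := Prod.ext h₁ h₂
  exact WithLp.ofLp_injective 2 this

variable [NormedAddCommGroup H]

instance : NormedAddCommGroup (Cplx H) :=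
  inferInstanceAs (NormedAddCommGroup (WithLp 2 (H × H)))

instance [CompleteSpace H] : CompleteSpace (Cplx H) :=
  inferInstanceAs (CompleteSpace (WithLp 2 (H × H)))

@[simp] theorem re_add (ξ η : Cplx H) : (ξ + η).re = ξ.re + η.re := rfl

@[simp] theorem im_add (ξ η : Cplx H) : (ξ + η).im = ξ.im + η.im := rfl

@[simp] theorem re_zero : (0 : Cplx H).re = 0 := rfl

@[simp] theorem im_zero : (0 : Cplx H).im = 0 := rfl

theorem norm_sq (ξ : Cplx H) : ‖ξ‖ ^ 2 = ‖ξ.re‖ ^ 2 + ‖ξ.im‖ ^ 2 :=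
  WithLp.prod_norm_sq_eq_of_L2 (α := H) (β := H) ξ

theorem continuous_re : Continuous (re : Cplx H → H) :=
  WithLp.continuous_fst (p := 2) (α := H) (β := H)

theorem continuous_im : Continuous (im : Cplx H → H) :=
  WithLp.continuous_snd (p := 2) (α := H) (β := H)

theorem continuous_mk : Continuous (fun p : H × H => mk p.1 p.2) :=
  WithLp.prod_continuous_toLp (p := 2) (α := H) (β := H)

variable [InnerProductSpace ℝ H]

/-- `(a + ib)(x + iy) = (ax - by) + i(ay + bx)`. -/
instance : Module ℂ (Cplx H) where
  smul c ξ := mk (c.re • ξ.re - c.im • ξ.im) (c.re • ξ.im + c.im • ξ.re)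
  one_smul ξ := by
    change mk _ _ = _
    ext <;> simp
  mul_smul a b ξ := by
    change mk _ _ = mk _ _
    ext <;> simp only [Complex.mul_re, Complex.mul_im, re_mk, im_mk]
    · change _ = a.re • (b.re • ξ.re - b.im • ξ.im) - a.im • (b.re • ξ.im + b.im • ξ.re)
      module
    · change _ = a.re • (b.re • ξ.im + b.im • ξ.re) + a.im • (b.re • ξ.re - b.im • ξ.im)
      module
  smul_zero a := by
    change mk _ _ = _
    ext <;> simp
  smul_add a ξ η := by
    change mk _ _ = mk _ _ + mk _ _
    ext <;> simp only [re_add, im_add, re_mk, im_mk] <;> module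
  add_smul a b ξ := by
    change mk _ _ = mk _ _ + mk _ _
    ext <;> simp only [re_add, im_add, re_mk, im_mk, Complex.add_re, Complex.add_im] <;> module
  zero_smul ξ := by
    change mk _ _ = _
    ext <;> simp

@[simp] theorem re_smul (c : ℂ) (ξ : Cplx H) : (c • ξ).re = c.re • ξ.re - c.im • ξ.im := rfl

@[simp] theorem im_smul (c : ℂ) (ξ : Cplx H) : (c • ξ).im = c.re • ξ.im + c.im • ξ.re := rfl

theorem norm_smul_eq (c : ℂ) (ξ : Cplx H) : ‖c • ξ‖ = ‖c‖ * ‖ξ‖ := by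
  rw [← sq_eq_sq₀ (norm_nonneg _) (by positivity), mul_pow, norm_sq, norm_sq,
    ← Complex.normSq_eq_norm_sq, Complex.normSq_apply, re_smul, im_smul, norm_sub_sq_real, norm_add_sq_real]
  simp only [norm_smul, real_inner_smul_left, real_inner_smul_right, mul_pow, Real.norm_eq_abs,
    sq_abs, real_inner_comm ξ.re ξ.im]
  ring

/-- With Mathlib's convention (conjugate linear in the first variable),
`⟪u + iv, x + iy⟫ = ⟪u, x⟫ + ⟪v, y⟫ + i (⟪u, y⟫ - ⟪v, x⟫)`. -/
instance : InnerProductSpace ℂ (Cplx H) where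
  norm_smul_le c ξ := (norm_smul_eq c ξ).le
  inner η ξ := ⟨inner ℝ η.re ξ.re + inner ℝ η.im ξ.im, inner ℝ η.re ξ.im - inner ℝ η.im ξ.re⟩
  norm_sq_eq_re_inner ξ := by
    rw [norm_sq]
    simp
  conj_inner_symm ξ η := by
    apply Complex.ext
    · simp [real_inner_comm]
    · simp [real_inner_comm]
  add_left ξ η ζ := by
    apply Complex.ext <;> simp [inner_add_left] <;> ring
  smul_left ξ η c := by
    apply Complex.ext <;>
      simp [inner_add_left, inner_sub_left, real_inner_smul_left] <;> ring

theorem inner_def (η ξ : Cplx H) : inner ℂ η ξ =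
    ⟨inner ℝ η.re ξ.re + inner ℝ η.im ξ.im, inner ℝ η.re ξ.im - inner ℝ η.im ξ.re⟩ := rfl

/-- The canonical copy of `H` inside `H + iH`. -/
def incl (x : H) : Cplx H := mk x 0

/-- The natural conjugation `C : x + iy ↦ x - iy`, a conjugate-linear isometry. -/
def conjC : Cplx H →ₗᵢ⋆[ℂ] Cplx H where
  toFun ξ := mk ξ.re (-ξ.im)
  map_add' ξ η := by ext <;> simp [add_comm]
  map_smul' c ξ := by
    ext
    · simp
    · simp [add_comm]
  norm_map' ξ := by
    rw [← sq_eq_sq₀ (norm_nonneg _) (norm_nonneg _)]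
    simp [norm_sq]

theorem conjC_apply (ξ : Cplx H) : conjC ξ = mk ξ.re (-ξ.im) := rfl

@[simp] theorem conjC_conjC (ξ : Cplx H) : conjC (conjC ξ) = ξ := by
  ext <;> simp [conjC_apply]

/-- `S♭ = C S C`. -/
def flat (S : Cplx H →L[ℂ] Cplx H) : Cplx H →L[ℂ] Cplx H :=
  conjC.toContinuousLinearMap.comp (S.comp conjC.toContinuousLinearMap)

theorem flat_apply (S : Cplx H →L[ℂ] Cplx H) (ξ : Cplx H) :
    flat S ξ = conjC (S (conjC ξ)) := rfl

/-- The complex extension `T_ℂ (x + iy) = T x + i T y` of a bounded real operator. -/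
def extend (T : H →L[ℝ] H) : Cplx H →L[ℂ] Cplx H where
  toFun ξ := mk (T ξ.re) (T ξ.im)
  map_add' ξ η := by ext <;> simp
  map_smul' c ξ := by ext <;> simp
  cont := continuous_mk.comp
    ((T.continuous.comp continuous_re).prodMk (T.continuous.comp continuous_im))

theorem extend_apply (T : H →L[ℝ] H) (ξ : Cplx H) : extend T ξ = mk (T ξ.re) (T ξ.im) := rfl

end Basic

end Cplx

/-! ## Conjugate symmetric sets -/

/-- A set of complex numbers that is stable under complex conjugation. -/
class ConjSymm (S : Set ℂ) : Prop where
  conj_mem : ∀ z ∈ S, conj z ∈ S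

/-- Complex conjugation as a map of a conjugate symmetric set into itself. -/
def conjPt {S : Set ℂ} [ConjSymm S] (z : S) : S := ⟨conj (z : ℂ), ConjSymm.conj_mem z z.2⟩

@[simp] theorem conjPt_conjPt {S : Set ℂ} [ConjSymm S] (z : S) : conjPt (conjPt z) = z :=
  Subtype.ext (Complex.conj_conj _)

theorem measurable_conjPt {S : Set ℂ} [ConjSymm S] : Measurable (conjPt : S → S) :=
  (Complex.continuous_conj.measurable.comp measurable_subtype_coe).subtype_mk

/-- The set `A^c = {z̄ : z ∈ A}` of the conjugates of the points of `A`. -/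
def conjSet {S : Set ℂ} [ConjSymm S] (A : Set S) : Set S := conjPt '' A

theorem conjSet_eq_preimage {S : Set ℂ} [ConjSymm S] (A : Set S) :
    conjSet A = conjPt ⁻¹' A :=
  congrFun (Set.image_eq_preimage_of_inverse conjPt_conjPt conjPt_conjPt) A

/-- The spectrum of a complex extension is conjugate symmetric. -/
instance {H : Type*} [NormedAddCommGroup H] [InnerProductSpace ℝ H] (T : H →L[ℝ] H) :
    ConjSymm (spectrum ℂ (Cplx.extend T)) where
  conj_mem z hz := by
    have flat_mul : ∀ A B : Cplx H →L[ℂ] Cplx H,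
        Cplx.flat (A * B) = Cplx.flat A * Cplx.flat B := by
      intro A B
      ext1 ξ
      simp [Cplx.flat_apply]
    have flat_one : Cplx.flat (1 : Cplx H →L[ℂ] Cplx H) = 1 := by
      ext1 ξ
      simp [Cplx.flat_apply]
    have key : Cplx.flat (algebraMap ℂ (Cplx H →L[ℂ] Cplx H) (conj z) - Cplx.extend T)
        = algebraMap ℂ (Cplx H →L[ℂ] Cplx H) z - Cplx.extend T := by
      ext1 ξ
      rw [Cplx.flat_apply]
      simp only [ContinuousLinearMap.sub_apply, Algebra.algebraMap_eq_smul_one,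
        ContinuousLinearMap.smul_apply, ContinuousLinearMap.one_apply, map_sub, map_smulₛₗ,
        Cplx.conjC_conjC, Complex.conj_conj]
      congr 1
      ext <;> simp [Cplx.extend_apply, Cplx.conjC_apply]
    intro h
    apply hz
    rw [spectrum.mem_resolventSet_iff] at h ⊢
    obtain ⟨u, hu⟩ := h
    rw [← key, ← hu]
    exact ⟨⟨Cplx.flat u, Cplx.flat (↑u⁻¹ : Cplx H →L[ℂ] Cplx H),
      by rw [← flat_mul, Units.mul_inv, flat_one],
      by rw [← flat_mul, Units.inv_mul, flat_one]⟩, rfl⟩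

/-! ## Spectral measures -/

/-- A spectral measure on the `σ`-algebra `m`, with values in the self-adjoint projections of the
real or complex Hilbert space `K`. The value on a set outside the `σ`-algebra is `0` by
convention, as for `MeasureTheory.VectorMeasure`. -/
structure SpectralMeasure (𝕜 : Type*) [RCLike 𝕜] {Ω : Type*} (m : MeasurableSpace Ω)
    (K : Type*) [NormedAddCommGroup K] [InnerProductSpace 𝕜 K] [CompleteSpace K] where
  toFun : Set Ω → K →L[𝕜] K
  not_measurable' : ∀ A, ¬ MeasurableSet A → toFun A = 0
  isStarProjection' : ∀ A, MeasurableSet A → IsStarProjection (toFun A)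
  empty' : toFun ∅ = 0
  univ' : toFun Set.univ = 1
  inter' : ∀ A B, MeasurableSet A → MeasurableSet B → toFun (A ∩ B) = toFun A * toFun B
  hasSum' : ∀ (x y : K) (A : ℕ → Set Ω), (∀ n, MeasurableSet (A n)) → Pairwise (Disjoint on A) →
    HasSum (fun n => inner 𝕜 y (toFun (A n) x)) (inner 𝕜 y (toFun (⋃ n, A n) x))

namespace SpectralMeasure

section General

variable {𝕜 : Type*} [RCLike 𝕜] {Ω : Type*} {m : MeasurableSpace Ω}
  {K : Type*} [NormedAddCommGroup K] [InnerProductSpace 𝕜 K] [CompleteSpace K]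

instance : CoeFun (SpectralMeasure 𝕜 m K) (fun _ => Set Ω → K →L[𝕜] K) := ⟨toFun⟩

/-- The scalar measure `ν_{x,y}(A) = ⟨F(A)x, y⟩`, with the inner product `⟨·,·⟩` linear in its
first variable; in Mathlib's convention this is `inner 𝕜 y (F A x)`. -/
def scalar (F : SpectralMeasure 𝕜 m K) (x y : K) : VectorMeasure Ω 𝕜 where
  measureOf' A := inner 𝕜 y (F A x)
  empty' := by simp [F.empty']
  not_measurable' A hA := by simp [F.not_measurable' A hA]
  m_iUnion' A hA hd := F.hasSum' x y A hA hd

theorem scalar_apply (F : SpectralMeasure 𝕜 m K) (x y : K) (A : Set Ω) :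
    F.scalar x y A = inner 𝕜 y (F A x) := rfl

theorem compl (F : SpectralMeasure 𝕜 m K) {A : Set Ω} (hA : MeasurableSet A) :
    F Aᶜ = 1 - F A := by
  ext1 x
  refine ext_inner_left 𝕜 fun y => ?_
  have h := VectorMeasure.of_add_of_sdiff (v := F.scalar x y) hA MeasurableSet.univ
    (Set.subset_univ A)
  rw [← Set.compl_eq_univ_sdiff] at h
  simp only [scalar_apply, F.univ'] at h
  rw [ContinuousLinearMap.sub_apply, inner_sub_right, ← h]
  ring

/-- `F`-null sets: the subsets of the sets `B` of the `σ`-algebra with `F(B) = 0`. -/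
def Null (F : SpectralMeasure 𝕜 m K) (A : Set Ω) : Prop :=
  ∃ B, MeasurableSet B ∧ A ⊆ B ∧ F B = 0

theorem null_iff (F : SpectralMeasure 𝕜 m K) {A : Set Ω} (hA : MeasurableSet A) :
    F.Null A ↔ F A = 0 := by
  refine ⟨fun ⟨B, hB, hAB, h0⟩ => ?_, fun h => ⟨A, hA, subset_rfl, h⟩⟩
  rw [← Set.inter_eq_left.mpr hAB, F.inter' A B hA hB, h0, mul_zero]

theorem Null.mono {F : SpectralMeasure 𝕜 m K} {A B : Set Ω} (hB : F.Null B) (h : A ⊆ B) :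
    F.Null A :=
  let ⟨D, hD, hBD, h0⟩ := hB
  ⟨D, hD, h.trans hBD, h0⟩

theorem null_empty (F : SpectralMeasure 𝕜 m K) : F.Null ∅ :=
  ⟨∅, MeasurableSet.empty, subset_rfl, F.empty'⟩

theorem Null.union {F : SpectralMeasure 𝕜 m K} {A B : Set Ω} (hA : F.Null A) (hB : F.Null B) :
    F.Null (A ∪ B) := by
  obtain ⟨D, hD, hAD, hD0⟩ := hA
  obtain ⟨D', hD', hBD', hD0'⟩ := hB
  refine ⟨D ∪ D', hD.union hD', Set.union_subset_union hAD hBD', ?_⟩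
  have h := F.compl (hD.union hD')
  rw [Set.compl_union, F.inter' _ _ hD.compl hD'.compl, F.compl hD, F.compl hD', hD0, hD0'] at h
  have h' : (1 : K →L[𝕜] K) = 1 - F (D ∪ D') := by simpa using h
  exact sub_eq_self.mp h'.symm

/-- The essential supremum `‖f‖_∞ = inf {r > 0 : F({|f| ≥ r}) = 0}` of a complex function. -/
def essNorm (F : SpectralMeasure 𝕜 m K) (f : Ω → ℂ) : ℝ :=
  sInf {r : ℝ | 0 < r ∧ F.Null {z | r ≤ ‖f z‖}}

/-- `f` is `F`-essentially bounded, that is, the set in the definition of `‖f‖_∞` is nonempty. -/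
def EssBounded (F : SpectralMeasure 𝕜 m K) (f : Ω → ℂ) : Prop :=
  ∃ r : ℝ, 0 < r ∧ F.Null {z | r ≤ ‖f z‖}

theorem essNorm_eq_zero_iff (F : SpectralMeasure 𝕜 m K) {f : Ω → ℂ} (hf : F.EssBounded f) :
    F.essNorm f = 0 ↔ ∀ r : ℝ, 0 < r → F.Null {z | r ≤ ‖f z‖} := by
  constructor
  · intro h r hr
    obtain ⟨s, ⟨hs, hn⟩, hsr⟩ := exists_lt_of_csInf_lt
      (s := {r : ℝ | 0 < r ∧ F.Null {z | r ≤ ‖f z‖}}) hf (by change F.essNorm f < r; rw [h]; exact hr)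
    exact hn.mono fun z hz => hsr.le.trans hz
  · intro h
    have : {r : ℝ | 0 < r ∧ F.Null {z | r ≤ ‖f z‖}} = Set.Ioi 0 := by
      ext r
      exact ⟨fun hr => hr.1, fun hr => ⟨hr, h r hr⟩⟩
    rw [essNorm, this, csInf_Ioi]

theorem EssBounded.add {F : SpectralMeasure 𝕜 m K} {f g : Ω → ℂ} (hf : F.EssBounded f)
    (hg : F.EssBounded g) : F.EssBounded (f + g) := by
  obtain ⟨r, hr, hr0⟩ := hf
  obtain ⟨s, hs, hs0⟩ := hg
  refine ⟨r + s, by positivity, (hr0.union hs0).mono fun z hz => ?_⟩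
  by_contra hc
  simp only [Set.mem_union, Set.mem_ofPred_eq, not_or, not_le] at hc
  have h1 : r + s ≤ ‖f z + g z‖ := hz
  linarith [norm_add_le (f z) (g z)]

theorem EssBounded.mul {F : SpectralMeasure 𝕜 m K} {f g : Ω → ℂ} (hf : F.EssBounded f)
    (hg : F.EssBounded g) : F.EssBounded (f * g) := by
  obtain ⟨r, hr, hr0⟩ := hf
  obtain ⟨s, hs, hs0⟩ := hg
  refine ⟨r * s, by positivity, (hr0.union hs0).mono fun z hz => ?_⟩
  by_contra hc
  simp only [Set.mem_union, Set.mem_ofPred_eq, not_or, not_le] at hc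
  have h1 : r * s ≤ ‖f z * g z‖ := hz
  rw [norm_mul] at h1
  exact absurd h1 (not_le.mpr (mul_lt_mul'' hc.1 hc.2 (norm_nonneg _) (norm_nonneg _)))

end General

section Complex

variable {Ω : Type*} {m : MeasurableSpace Ω}
  {K : Type*} [NormedAddCommGroup K] [InnerProductSpace ℂ K] [CompleteSpace K]

/-- `B = ∫ f dF` in the weak sense: every pair `x`, `y` satisfies `⟨Bx, y⟩ = ∫ f dν_{x,y}`, the
integral of a (variation-)integrable function against the complex measure `ν_{x,y}`. -/
def HasIntegral (F : SpectralMeasure ℂ m K) (f : Ω → ℂ) (B : K →L[ℂ] K) : Prop :=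
  ∀ x y : K, (F.scalar x y).Integrable f ∧
    inner ℂ y (B x) = ∫ᵛ z, f z ∂[ContinuousLinearMap.mul ℝ ℂ; F.scalar x y]

end Complex

section Stem

variable {S : Set ℂ} [ConjSymm S] {K : Type*} [NormedAddCommGroup K] [InnerProductSpace ℂ K]
  [CompleteSpace K] (F : SpectralMeasure ℂ (Subtype.instMeasurableSpace : MeasurableSpace S) K)

/-- The `σ`-algebra of the Borel sets `A ⊆ S` with `F(A) = F(A^c)`, where `A^c = {z̄ : z ∈ A}`. -/
def symmBorel : MeasurableSpace S :=
  MeasurableSpace.DynkinSystem.toMeasurableSpace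
    { Has := fun A => MeasurableSet A ∧ F A = F (conjSet A)
      has_empty := ⟨MeasurableSet.empty, by simp [conjSet]⟩
      has_compl := by
        rintro A ⟨hA, h⟩
        refine ⟨hA.compl, ?_⟩
        have hA' := measurable_conjPt hA
        rw [conjSet_eq_preimage] at h ⊢
        rw [Set.preimage_compl, F.compl hA, F.compl hA', h]
      has_iUnion_nat := by
        rintro A hd hA
        refine ⟨MeasurableSet.iUnion fun n => (hA n).1, ?_⟩
        rw [conjSet_eq_preimage, Set.preimage_iUnion]
        ext1 x
        refine ext_inner_left ℂ fun y => ?_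
        refine (F.hasSum' x y A (fun n => (hA n).1) hd).unique ?_
        have h := F.hasSum' x y (fun n => conjPt ⁻¹' A n) (fun n => measurable_conjPt (hA n).1)
          (fun i j hij => (hd hij).preimage _)
        refine h.congr_fun ?_
        intro n
        rw [(hA n).2, conjSet_eq_preimage] }
    (by
      rintro A B ⟨hA, hA'⟩ ⟨hB, hB'⟩
      refine ⟨hA.inter hB, ?_⟩
      rw [conjSet_eq_preimage] at *
      rw [Set.preimage_inter, F.inter' _ _ hA hB,
        F.inter' _ _ (measurable_conjPt hA) (measurable_conjPt hB), hA', hB'])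

theorem measurableSet_symmBorel {A : Set S} :
    MeasurableSet[F.symmBorel] A ↔ MeasurableSet A ∧ F A = F (conjSet A) := Iff.rfl

/-- The real `*`-algebra of the `F`-essentially bounded Borel functions `f : S → ℂ` that are
`F`-stem functions: `f(z̄) = conj (f z)` outside an `F`-null set. -/
def stemFun : StarSubalgebra ℝ (S → ℂ) where
  carrier := {f | Measurable f ∧ F.EssBounded f ∧ F.Null {z | f (conjPt z) ≠ conj (f z)}}
  add_mem' := by
    rintro f g ⟨hf, bf, sf⟩ ⟨hg, bg, sg⟩
    refine ⟨hf.add hg, bf.add bg, (sf.union sg).mono fun z hz => ?_⟩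
    by_contra hc
    simp only [Set.mem_union, Set.mem_ofPred_eq, not_or, not_not] at hc
    exact hz (by simp [hc.1, hc.2])
  mul_mem' := by
    rintro f g ⟨hf, bf, sf⟩ ⟨hg, bg, sg⟩
    refine ⟨hf.mul hg, bf.mul bg, (sf.union sg).mono fun z hz => ?_⟩
    by_contra hc
    simp only [Set.mem_union, Set.mem_ofPred_eq, not_or, not_not] at hc
    exact hz (by simp [hc.1, hc.2])
  algebraMap_mem' r := by
    refine ⟨measurable_const, ⟨|r| + 1, by positivity, F.null_empty.mono fun z hz => ?_⟩,
      F.null_empty.mono fun z hz => ?_⟩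
    · have h : |r| + 1 ≤ ‖(r : ℂ)‖ := hz
      rw [Complex.norm_real, Real.norm_eq_abs] at h
      linarith
    · exact hz (Complex.conj_ofReal r).symm
  star_mem' := by
    rintro f ⟨hf, ⟨r, hr, hr0⟩, sf⟩
    refine ⟨Complex.continuous_conj.measurable.comp hf, ⟨r, hr, hr0.mono fun z hz => ?_⟩,
      sf.mono fun z hz => ?_⟩
    · simpa using hz
    · intro h
      exact hz (congrArg conj h)

/-- The ideal of the functions with `‖f‖_∞ = 0`. -/
def nullFun : Ideal F.stemFun where
  carrier := {f | F.essNorm f = 0}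
  zero_mem' := by
    refine (F.essNorm_eq_zero_iff (0 : F.stemFun).2.2.1).mpr fun r hr =>
      F.null_empty.mono fun z hz => ?_
    have h : r ≤ ‖(0 : ℂ)‖ := hz
    rw [norm_zero] at h
    linarith
  add_mem' := by
    intro f g hf hg
    refine (F.essNorm_eq_zero_iff (f + g).2.2.1).mpr fun r hr => ?_
    have h1 := (F.essNorm_eq_zero_iff f.2.2.1).mp hf (r / 2) (by positivity)
    have h2 := (F.essNorm_eq_zero_iff g.2.2.1).mp hg (r / 2) (by positivity)
    refine (h1.union h2).mono fun z hz => ?_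
    by_contra hc
    simp only [Set.mem_union, Set.mem_ofPred_eq, not_or, not_le] at hc
    have h3 : r ≤ ‖(f : S → ℂ) z + (g : S → ℂ) z‖ := hz
    linarith [norm_add_le ((f : S → ℂ) z) ((g : S → ℂ) z), hc.1, hc.2]
  smul_mem' := by
    intro h f hf
    refine (F.essNorm_eq_zero_iff (h • f).2.2.1).mpr fun r hr => ?_
    obtain ⟨s, hs, hs0⟩ := h.2.2.1
    have h1 := (F.essNorm_eq_zero_iff f.2.2.1).mp hf (r / s) (by positivity)
    refine (hs0.union h1).mono fun z hz => ?_
    by_contra hc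
    simp only [Set.mem_union, Set.mem_ofPred_eq, not_or, not_le] at hc
    have h3 : r ≤ ‖(h : S → ℂ) z * (f : S → ℂ) z‖ := hz
    rw [norm_mul] at h3
    have h4 := mul_lt_mul'' hc.1 hc.2 (norm_nonneg _) (norm_nonneg _)
    rw [mul_div_cancel₀ r hs.ne'] at h4
    linarith

/-- The real algebra `L^∞_s(S, F)` of the classes of `F`-essentially bounded `F`-stem functions. -/
abbrev LinfStem : Type _ := F.stemFun ⧸ F.nullFun

/-- The class of a function in `L^∞_s(S, F)`. -/
def cls (f : F.stemFun) : F.LinfStem := Ideal.Quotient.mk F.nullFun f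

end Stem

end SpectralMeasure

/-- `E` is the spectral measure of the bounded operator `N` on the complex Hilbert space `K`: it is
a spectral measure on the Borel subsets of the spectrum of `N`, and `N = ∫ z dE(z)`. -/
def IsSpectralMeasureOf {K : Type*} [NormedAddCommGroup K] [InnerProductSpace ℂ K]
    [CompleteSpace K] (N : K →L[ℂ] K)
    (E : SpectralMeasure ℂ (Subtype.instMeasurableSpace : MeasurableSpace (spectrum ℂ N)) K) :
    Prop :=
  E.HasIntegral (fun z => (z : ℂ)) N

/-- The complex spectrum `{u + iv : (u - T)² + v² is not invertible}` of a real operator. -/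
def complexSpectrum {X : Type*} [NormedAddCommGroup X] [NormedSpace ℝ X] (T : X →L[ℝ] X) :
    Set ℂ :=
  {z | ¬ IsUnit ((z.re • (1 : X →L[ℝ] X) - T) ^ 2 + (z.im ^ 2) • (1 : X →L[ℝ] X))}

/-! ## Hilbert `ℍ`-spaces -/

/-- A Hilbert `ℍ`-space: a real Hilbert space which is a left and a right `ℍ`-vector space, with
real quaternions acting as real scalars, such that `⟨q x, y⟩ = ⟨x, q* y⟩` and `⟨x q, y⟩ = ⟨x, y q*⟩`. The product `x q` is written
`MulOpposite.op q • x`. The compatibility `(q x) s = q (x s)` of the two multiplications is not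
needed and not required. -/
class HilbertHSpace (H : Type*) [NormedAddCommGroup H] [InnerProductSpace ℝ H] [CompleteSpace H]
    [Module ℍ H] [Module ℍᵐᵒᵖ H] : Prop where
  coe_left_mul : ∀ (r : ℝ) (x : H), (r : ℍ) • x = r • x
  coe_right_mul : ∀ (r : ℝ) (x : H), MulOpposite.op (r : ℍ) • x = r • x
  inner_left_mul : ∀ (q : ℍ) (x y : H), inner ℝ (q • x) y = inner ℝ x (star q • y)
  inner_right_mul : ∀ (q : ℍ) (x y : H),
    inner ℝ (MulOpposite.op q • x) y = inner ℝ x (MulOpposite.op (star q) • y)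

section Quaternionic

variable (H : Type*) [NormedAddCommGroup H] [InnerProductSpace ℝ H] [CompleteSpace H]
  [Module ℍ H] [Module ℍᵐᵒᵖ H] [HilbertHSpace H]

/-- The real algebra of the bounded right `ℍ`-linear operators on `H`. -/
def rightLinear : Subalgebra ℝ (H →L[ℝ] H) where
  carrier := {T | ∀ (q : ℍ) (x : H), T (MulOpposite.op q • x) = MulOpposite.op q • T x}
  mul_mem' := by
    intro S T hS hT q x
    simp only [ContinuousLinearMap.mul_apply]
    rw [hT, hS]
  add_mem' := by
    intro S T hS hT q x
    simp only [ContinuousLinearMap.add_apply]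
    rw [hT, hS, smul_add]
  algebraMap_mem' r := by
    intro q x
    simp only [Algebra.algebraMap_eq_smul_one, ContinuousLinearMap.smul_apply,
      ContinuousLinearMap.one_apply]
    rw [← HilbertHSpace.coe_right_mul, ← HilbertHSpace.coe_right_mul, ← mul_smul, ← mul_smul,
      ← MulOpposite.op_mul, ← MulOpposite.op_mul, Quaternion.coe_commutes]

variable {H}

/-- The right multiplication `(x + iy) q = x q + i (y q)` by a quaternion on `H + iH`. -/
def rightMulC (q : ℍ) (ξ : Cplx H) : Cplx H :=
  Cplx.mk (MulOpposite.op q • ξ.re) (MulOpposite.op q • ξ.im)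

/-- Right `ℍ`-linearity of a bounded operator on `H + iH`. -/
def IsRightLinearC (S : Cplx H →L[ℂ] Cplx H) : Prop :=
  ∀ (q : ℍ) (ξ : Cplx H), S (rightMulC q ξ) = rightMulC q (S ξ)

end Quaternionic

end

/-! The theorem follows from the complex spectral theorem and a symmetry. The operator `extend T` is
normal on `Cplx H` and is fixed by `flat`. Hence `A ↦ flat (E (conjSet A))` is again a spectral
measure representing `extend T`, and uniqueness gives E(A^c) = E(A)♭ (`conjugate_eq`, `flat_eq`).
The sets with E(A) = E(A^c) are therefore those whose projection commutes with C. The integral of a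
function with f(z̄) = conj f(z) almost everywhere commutes with C as well. An operator commuting
with C is the extension of a real operator (`extend_rePart`), so these projections and integrals
descend to H. Since `extend` is injective, multiplicative, isometric and compatible with adjoints,
every identity of the complex calculus descends too.

The complex calculus is built on the quadratic forms ⟨Bx, x⟩. By polarization they determine B, and
bounded limits of such forms are again of this kind (`exists_inner_self_eq_of_tendsto`). The
integral of f is thus the operator whose form is ∫ f dμ_x, with μ_x(A) = ‖E(A)x‖². Multiplicativity
rests on the fact that replacing x by E(A)x restricts μ_x to A (`diagMeasure_proj`), and it gives
‖Bx‖² = ∫ |f|² dμ_x and the isometry `norm_eq`. The spectral measure itself comes from the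
continuous functional calculus through Riesz–Markov and a π-λ argument (`exists_spectralMeasure`).

Whatever commutes with T commutes with E by Fuglede's theorem. This proves (v), and it also proves
right linearity, which means commuting with all right multiplications. For (iv), the function 1/((w
− z)(w − z̄)), cut off to a conjugation invariant part of A, is a bounded stem function, and its
integral inverts the quadratic polynomial in T on the range of E_ℝ(A). -/

open Filter Topology

/-! ### Polarization and weak limits of operators. -/

section Quadratic

variable {K : Type*} [NormedAddCommGroup K] [InnerProductSpace ℂ K]

/-- The sesquilinear polarization of a function `q`, linear in the first variable if `q` is a
quadratic form. -/
noncomputable def polar (q : K → ℂ) (x y : K) : ℂ :=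
  (q (x + y) - q (x - y) + Complex.I * q (x + Complex.I • y)
    - Complex.I * q (x - Complex.I • y)) / 4

theorem tendsto_polar {ι : Type*} {l : Filter ι} {q : ι → K → ℂ} {q₀ : K → ℂ}
    (h : ∀ x, Tendsto (fun i => q i x) l (𝓝 (q₀ x))) (x y : K) :
    Tendsto (fun i => polar (q i) x y) l (𝓝 (polar q₀ x y)) :=
  ((((h _).sub (h _)).add ((h _).const_mul _)).sub ((h _).const_mul _)).div_const _

/-- Two parallelogram laws make the four squared norms add up to 4(‖x‖² + ‖y‖²), which the
denominator of `polar` absorbs. -/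
theorem norm_polar_le {q : K → ℂ} {C : ℝ} (h : ∀ x, ‖q x‖ ≤ C * ‖x‖ ^ 2) (x y : K) :
    ‖polar q x y‖ ≤ C * (‖x‖ ^ 2 + ‖y‖ ^ 2) := by
  have h1 := parallelogram_law_with_norm ℂ x y
  have h2 := parallelogram_law_with_norm ℂ x (Complex.I • y)
  rw [norm_smul, Complex.norm_I, one_mul] at h2
  have h3 : ‖q (x + y) - q (x - y) + Complex.I * q (x + Complex.I • y)
      - Complex.I * q (x - Complex.I • y)‖ ≤
      ‖q (x + y)‖ + ‖q (x - y)‖ + ‖q (x + Complex.I • y)‖ + ‖q (x - Complex.I • y)‖ := by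
    refine (norm_sub_le _ _).trans ?_
    rw [norm_mul, Complex.norm_I, one_mul]
    gcongr
    refine (norm_add_le _ _).trans ?_
    rw [norm_mul, Complex.norm_I, one_mul]
    gcongr
    exact norm_sub_le _ _
  rw [polar, norm_div, RCLike.norm_ofNat, div_le_iff₀ (by norm_num)]
  refine h3.trans ?_
  calc _ ≤ C * ‖x + y‖ ^ 2 + C * ‖x - y‖ ^ 2 + C * ‖x + Complex.I • y‖ ^ 2
        + C * ‖x - Complex.I • y‖ ^ 2 := by
        gcongr <;> apply h
    _ = C * (‖x + y‖ ^ 2 + ‖x - y‖ ^ 2) + C * (‖x + Complex.I • y‖ ^ 2 +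
        ‖x - Complex.I • y‖ ^ 2) := by ring
    _ = _ := by rw [h1, h2]; ring

variable [CompleteSpace K]

theorem inner_eq_polar (B : K →L[ℂ] K) (x y : K) :
    inner ℂ y (B x) = polar (fun z => inner ℂ z (B z)) x y := by
  -- The polarization identity used here has the operator in the conjugate linear slot, hence the
  -- adjoint.
  have h := inner_map_polarization (ContinuousLinearMap.adjoint B : K →L[ℂ] K).toLinearMap x y
  simpa only [ContinuousLinearMap.coe_coe, ContinuousLinearMap.adjoint_inner_left, polar] using h

theorem eq_of_inner_self_eq {A B : K →L[ℂ] K} (h : ∀ x, inner ℂ x (A x) = inner ℂ x (B x)) :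
    A = B := by
  ext1 x
  refine ext_inner_left ℂ fun y => ?_
  rw [inner_eq_polar, inner_eq_polar, funext h]

theorem tendsto_inner_of_tendsto_inner_self {ι : Type*} {l : Filter ι} {B : ι → K →L[ℂ] K}
    {B₀ : K →L[ℂ] K} (h : ∀ x, Tendsto (fun i => inner ℂ x (B i x)) l (𝓝 (inner ℂ x (B₀ x))))
    (x y : K) : Tendsto (fun i => inner ℂ y (B i x)) l (𝓝 (inner ℂ y (B₀ x))) := by
  simp_rw [inner_eq_polar _ x y]
  exact tendsto_polar h x y

theorem hasSum_inner_of_hasSum_inner_self {ι : Type*} {B : ι → K →L[ℂ] K} {B₀ : K →L[ℂ] K}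
    (h : ∀ x, HasSum (fun i => inner ℂ x (B i x)) (inner ℂ x (B₀ x))) (x y : K) :
    HasSum (fun i => inner ℂ y (B i x)) (inner ℂ y (B₀ x)) := by
  simp_rw [inner_eq_polar _ x y]
  exact ((((h _).sub (h _)).add ((h _).mul_left _)).sub ((h _).mul_left _)).div_const _

theorem norm_inner_le_of_norm_inner_self_le {B : K →L[ℂ] K} {C : ℝ}
    (h : ∀ x, ‖inner ℂ x (B x)‖ ≤ C * ‖x‖ ^ 2) (x y : K) :
    ‖inner ℂ y (B x)‖ ≤ 2 * C * ‖x‖ * ‖y‖ := by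
  rcases eq_or_ne x 0 with rfl | hx
  · simp
  rcases eq_or_ne y 0 with rfl | hy
  · simp
  have hx' := norm_pos_iff.mpr hx
  have hy' := norm_pos_iff.mpr hy
  -- Both rescaled vectors have norm ‖x‖‖y‖, which balances the sum of squares; one factor ‖x‖‖y‖
  -- then cancels.
  have h1 : ‖inner ℂ (((‖x‖ : ℝ) : ℂ) • y) (B (((‖y‖ : ℝ) : ℂ) • x))‖ ≤
      C * (‖((‖y‖ : ℝ) : ℂ) • x‖ ^ 2 + ‖((‖x‖ : ℝ) : ℂ) • y‖ ^ 2) := by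
    rw [inner_eq_polar]
    exact norm_polar_le h _ _
  simp only [map_smul, inner_smul_left, inner_smul_right, norm_mul, norm_smul, RCLike.norm_conj,
    Complex.norm_real, norm_norm] at h1
  have h2 : (‖x‖ * ‖y‖) * ‖inner ℂ y (B x)‖ ≤ (‖x‖ * ‖y‖) * (2 * C * ‖x‖ * ‖y‖) := by
    nlinarith
  exact le_of_mul_le_mul_left h2 (by positivity)

/-- The polarization of q is a pointwise limit of sesquilinear forms, hence sesquilinear, and the
uniform bound survives the limit; Riesz representation supplies the operator. Spectral projections
and integrals are both obtained this way. -/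
theorem exists_inner_self_eq_of_tendsto {ι : Type*} {l : Filter ι} [l.NeBot] {B : ι → K →L[ℂ] K}
    {q : K → ℂ} {C : ℝ} (hC : ∀ i x, ‖inner ℂ x (B i x)‖ ≤ C * ‖x‖ ^ 2)
    (h : ∀ x, Tendsto (fun i => inner ℂ x (B i x)) l (𝓝 (q x))) :
    ∃ B₀ : K →L[ℂ] K, ∀ x, inner ℂ x (B₀ x) = q x := by
  have hlim (x y : K) : Tendsto (fun i => inner ℂ y (B i x)) l (𝓝 (polar q x y)) := by
    simp_rw [inner_eq_polar _ x y]
    exact tendsto_polar h x y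
  let b : K →ₗ⋆[ℂ] K →ₗ[ℂ] ℂ := LinearMap.mk₂'ₛₗ (starRingEnd ℂ) (RingHom.id ℂ)
    (fun y x => polar q x y)
    (fun y y' x => tendsto_nhds_unique (hlim x (y + y'))
      (by simpa only [inner_add_left] using (hlim x y).add (hlim x y')))
    (fun c y x => tendsto_nhds_unique (hlim x (c • y))
      (by simpa only [inner_smul_left, smul_eq_mul] using (hlim x y).const_mul (conj c)))
    (fun y x x' => tendsto_nhds_unique (hlim (x + x') y)
      (by simpa only [map_add, inner_add_right] using (hlim x y).add (hlim x' y)))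
    (fun c y x => tendsto_nhds_unique (hlim (c • x) y)
      (by simpa only [map_smul, inner_smul_right, smul_eq_mul, RingHom.id_apply] using (hlim x y).const_mul c))
  have hb (y x : K) : ‖b y x‖ ≤ 2 * C * ‖y‖ * ‖x‖ := by
    refine le_of_tendsto (hlim x y).norm (Eventually.of_forall fun i => ?_)
    rw [mul_right_comm]
    exact norm_inner_le_of_norm_inner_self_le (hC i) x y
  refine ⟨ContinuousLinearMap.adjoint
    (InnerProductSpace.continuousLinearMapOfBilin (b.mkContinuous₂ (2 * C) hb)), fun x => ?_⟩
  rw [ContinuousLinearMap.adjoint_inner_right,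
    InnerProductSpace.continuousLinearMapOfBilin_apply, LinearMap.mkContinuous₂_apply]
  refine tendsto_nhds_unique (hlim x x) (h x)

end Quadratic

/-! ### Integration of bounded Borel functions, tested on the diagonal. -/

/-- An induction principle for the bounded measurable functions with complex values. -/
theorem Measurable.bounded_induction {Ω : Type*} [MeasurableSpace Ω] {P : (Ω → ℂ) → Prop}
    (indicator : ∀ (c : ℂ) (A : Set Ω), MeasurableSet A → P (A.indicator fun _ => c))
    (add : ∀ f g : Ω → ℂ, Measurable f → Measurable g → (∃ C, ∀ z, ‖f z‖ ≤ C) →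
      (∃ C, ∀ z, ‖g z‖ ≤ C) → P f → P g → P (f + g))
    (lim : ∀ (f : ℕ → Ω → ℂ) (g : Ω → ℂ) (C : ℝ), (∀ n, Measurable (f n)) → Measurable g →
      (∀ n z, ‖f n z‖ ≤ C) → (∀ z, ‖g z‖ ≤ C) →
      (∀ z, Tendsto (fun n => f n z) atTop (𝓝 (g z))) → (∀ n, P (f n)) → P g)
    {f : Ω → ℂ} (hf : Measurable f) {C : ℝ} (hC : ∀ z, ‖f z‖ ≤ C) : P f := by
  have hs (s : SimpleFunc Ω ℂ) : P s := by
    induction s using SimpleFunc.induction with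
    | const c hA =>
      convert! indicator c _ hA
    | add hd h₁ h₂ =>
      exact add _ _ (SimpleFunc.measurable _) (SimpleFunc.measurable _)
        (SimpleFunc.exists_forall_norm_le _) (SimpleFunc.exists_forall_norm_le _) h₁ h₂
  -- The approximants started at 0 satisfy only ‖fₙ z‖ ≤ ‖f z‖ + ‖f z‖, whence the bound C + C.
  refine lim (fun n => SimpleFunc.approxOn f hf Set.univ 0 (Set.mem_univ _) n) f (C + C)
    (fun n => SimpleFunc.measurable _) hf (fun n z => ?_) (fun z => ?_) (fun z => ?_) fun n => hs _
  · exact (SimpleFunc.norm_approxOn_zero_le hf (Set.mem_univ 0) z n).trans (add_le_add (hC z) (hC z))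
  · linarith [hC z, norm_nonneg (f z)]
  · exact SimpleFunc.tendsto_approxOn hf (Set.mem_univ _) (by simp)

namespace SpectralMeasure

section Diagonal

variable {Ω : Type*} {m : MeasurableSpace Ω}
  {K : Type*} [NormedAddCommGroup K] [InnerProductSpace ℂ K] [CompleteSpace K]
  (E : SpectralMeasure ℂ m K)

theorem adjoint_eq {A : Set Ω} (hA : MeasurableSet A) :
    ContinuousLinearMap.adjoint (E A) = E A :=
  (E.isStarProjection' A hA).isSelfAdjoint

theorem mul_self_eq {A : Set Ω} (hA : MeasurableSet A) : E A * E A = E A :=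
  (E.isStarProjection' A hA).isIdempotentElem

theorem inner_apply {A : Set Ω} (hA : MeasurableSet A) (x y : K) :
    inner ℂ y (E A x) = inner ℂ (E A y) (E A x) := by
  conv_lhs => rw [← E.mul_self_eq hA]
  rw [mul_apply_eq_comp, ← ContinuousLinearMap.adjoint_inner_left, E.adjoint_eq hA]

theorem inner_self_apply {A : Set Ω} (hA : MeasurableSet A) (x : K) :
    inner ℂ x (E A x) = ((‖E A x‖ ^ 2 : ℝ) : ℂ) := by
  rw [E.inner_apply hA, inner_self_eq_norm_sq_to_K]
  push_cast
  rfl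

/-- The positive measure `A ↦ ⟨E(A)x, x⟩ = ‖E(A)x‖²`. -/
noncomputable def diagMeasure (x : K) : Measure Ω :=
  Measure.ofMeasurable (fun A _ => ENNReal.ofReal (‖E A x‖ ^ 2)) (by simp [E.empty'])
    (by
      intro A hA hd
      have h := Complex.hasSum_re (E.hasSum' x x A hA hd)
      simp only [E.inner_self_apply (hA _), E.inner_self_apply (MeasurableSet.iUnion hA),
        Complex.ofReal_re] at h
      rw [← ENNReal.ofReal_tsum_of_nonneg (fun _ => by positivity) h.summable, h.tsum_eq])

theorem diagMeasure_apply (x : K) {A : Set Ω} (hA : MeasurableSet A) :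
    E.diagMeasure x A = ENNReal.ofReal (‖E A x‖ ^ 2) :=
  Measure.ofMeasurable_apply A hA

theorem diagMeasure_real (x : K) {A : Set Ω} (hA : MeasurableSet A) :
    (E.diagMeasure x).real A = ‖E A x‖ ^ 2 := by
  rw [Measure.real, E.diagMeasure_apply x hA, ENNReal.toReal_ofReal (by positivity)]

instance (x : K) : IsFiniteMeasure (E.diagMeasure x) :=
  ⟨by rw [E.diagMeasure_apply x MeasurableSet.univ]; exact ENNReal.ofReal_lt_top⟩

theorem diagMeasure_univ (x : K) : (E.diagMeasure x).real Set.univ = ‖x‖ ^ 2 := by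
  rw [E.diagMeasure_real x MeasurableSet.univ, E.univ', one_apply_eq_self]

theorem ae_of_null {p : Ω → Prop} (h : E.Null {z | ¬ p z}) (x : K) :
    ∀ᵐ z ∂E.diagMeasure x, p z := by
  obtain ⟨B, hB, hs, h0⟩ := h
  exact measure_mono_null hs (by simp [E.diagMeasure_apply x hB, h0])

/-- Compressing a form by E(A) amounts to restricting its measure to A. Commutation with the
projections and multiplicativity of the integral both come from this. -/
theorem diagMeasure_proj (x : K) {A : Set Ω} (hA : MeasurableSet A) :
    E.diagMeasure (E A x) = (E.diagMeasure x).restrict A := by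
  ext B hB
  rw [Measure.restrict_apply hB, E.diagMeasure_apply _ hB, E.diagMeasure_apply _ (hB.inter hA),
    E.inter' _ _ hB hA, mul_apply_eq_comp]

theorem EssBounded.ae_le {E : SpectralMeasure ℂ m K} {f : Ω → ℂ} (hf : E.EssBounded f) :
    ∃ C, ∀ x, ∀ᵐ z ∂E.diagMeasure x, ‖f z‖ ≤ C := by
  obtain ⟨r, -, h⟩ := hf
  exact ⟨r, E.ae_of_null (h.mono fun z hz => (not_le.mp hz).le)⟩

theorem essBounded_of_le {f : Ω → ℂ} {C : ℝ} (h : ∀ z, ‖f z‖ ≤ C) : E.EssBounded f :=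
  ⟨|C| + 1, by positivity, E.null_empty.mono fun z hz => by
    have h1 : |C| + 1 ≤ ‖f z‖ := hz
    linarith [h z, le_abs_self C]⟩

theorem EssBounded.integrable {E : SpectralMeasure ℂ m K} {f : Ω → ℂ} (hf : E.EssBounded f)
    (hm : Measurable f) (x : K) : Integrable f (E.diagMeasure x) :=
  let ⟨_, hC⟩ := hf.ae_le
  Integrable.of_bound hm.aestronglyMeasurable _ (hC x)

theorem EssBounded.star {E : SpectralMeasure ℂ m K} {f : Ω → ℂ} (hf : E.EssBounded f) :
    E.EssBounded (fun z => conj (f z)) := by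
  simpa [EssBounded] using hf

/-- Setting f to zero on the null set {‖f‖ ≥ r} reduces essentially bounded functions to bounded
ones, where induction and dominated convergence apply. -/
theorem EssBounded.exists_bounded {E : SpectralMeasure ℂ m K} {f : Ω → ℂ} (hf : E.EssBounded f)
    (hm : Measurable f) :
    ∃ (g : Ω → ℂ) (C : ℝ), Measurable g ∧ (∀ z, ‖g z‖ ≤ C) ∧ E.Null {z | ¬ f z = g z} := by
  obtain ⟨r, hr, h⟩ := hf
  refine ⟨{z | ‖f z‖ < r}.indicator f, r, hm.indicator (measurableSet_lt hm.norm measurable_const),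
    fun z => ?_, h.mono fun z hz => ?_⟩
  · by_cases hz : ‖f z‖ < r
    · rw [Set.indicator_of_mem (by exact hz)]
      exact hz.le
    · rw [Set.indicator_of_notMem (by exact hz), norm_zero]
      exact hr.le
  · by_contra hc
    have hlt : ‖f z‖ < r := lt_of_not_ge hc
    exact hz (by rw [Set.indicator_of_mem (by exact hlt)])

/-- `⟨Bx, x⟩ = ∫ f dμ_{x,x}` for all `x`: the operator `B` is the integral of `f`, tested on the
diagonal. -/
def HasDiagIntegral (f : Ω → ℂ) (B : K →L[ℂ] K) : Prop :=
  ∀ x, inner ℂ x (B x) = ∫ z, f z ∂E.diagMeasure x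

variable {E} {f g : Ω → ℂ} {B D : K →L[ℂ] K}

theorem HasDiagIntegral.unique (h : E.HasDiagIntegral f B) (h' : E.HasDiagIntegral f D) : B = D :=
  eq_of_inner_self_eq fun x => (h x).trans (h' x).symm

theorem HasDiagIntegral.congr (h : E.HasDiagIntegral f B) (hfg : E.Null {z | ¬ f z = g z}) :
    E.HasDiagIntegral g B :=
  fun x => (h x).trans (integral_congr_ae (E.ae_of_null hfg x))

theorem HasDiagIntegral.add (h : E.HasDiagIntegral f B) (h' : E.HasDiagIntegral g D)
    (hf : Measurable f) (bf : E.EssBounded f) (hg : Measurable g) (bg : E.EssBounded g) :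
    E.HasDiagIntegral (f + g) (B + D) := by
  intro x
  rw [add_apply, inner_add_right, h x, h' x, ← integral_add (bf.integrable hf x)
    (bg.integrable hg x)]
  rfl

theorem HasDiagIntegral.smul (h : E.HasDiagIntegral f B) (c : ℂ) :
    E.HasDiagIntegral (c • f) (c • B) := by
  intro x
  rw [smul_apply, inner_smul_right, h x, ← integral_const_mul]
  rfl

theorem HasDiagIntegral.adjoint (h : E.HasDiagIntegral f B) :
    E.HasDiagIntegral (fun z => conj (f z)) (ContinuousLinearMap.adjoint B) := by
  intro x
  rw [ContinuousLinearMap.adjoint_inner_right, ← inner_conj_symm, h x, ← integral_conj]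

variable (E) in
theorem hasDiagIntegral_indicator (c : ℂ) {A : Set Ω} (hA : MeasurableSet A) :
    E.HasDiagIntegral (A.indicator fun _ => c) (c • E A) := by
  intro x
  rw [integral_indicator hA, integral_const, smul_apply, inner_smul_right, E.inner_self_apply hA,
    measureReal_restrict_apply_univ, E.diagMeasure_real x hA, Complex.real_smul, mul_comm]

variable (E) in
theorem hasDiagIntegral_one : E.HasDiagIntegral 1 1 := by
  have h := E.hasDiagIntegral_indicator 1 MeasurableSet.univ
  rwa [Set.indicator_univ, one_smul, E.univ'] at h

theorem HasDiagIntegral.norm_inner_self_le (h : E.HasDiagIntegral f B) {C : ℝ}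
    (hC : ∀ z, ‖f z‖ ≤ C) (x : K) : ‖inner ℂ x (B x)‖ ≤ C * ‖x‖ ^ 2 := by
  rw [h x, ← E.diagMeasure_univ x]
  exact norm_integral_le_of_norm_le_const (Eventually.of_forall hC)

theorem tendsto_integral_diagMeasure {f : ℕ → Ω → ℂ} {C : ℝ} (hf : ∀ n, Measurable (f n))
    (hC : ∀ n z, ‖f n z‖ ≤ C) (h : ∀ z, Tendsto (fun n => f n z) atTop (𝓝 (g z))) (x : K) :
    Tendsto (fun n => ∫ z, f n z ∂E.diagMeasure x) atTop (𝓝 (∫ z, g z ∂E.diagMeasure x)) :=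
  tendsto_integral_of_dominated_convergence (fun _ => C)
    (fun n => (hf n).aestronglyMeasurable) (integrable_const C)
    (fun n => Eventually.of_forall (hC n)) (Eventually.of_forall h)

variable (E) in
theorem exists_hasDiagIntegral_of_le (hf : Measurable f) {C : ℝ} (hC : ∀ z, ‖f z‖ ≤ C) :
    ∃ B, E.HasDiagIntegral f B := by
  refine Measurable.bounded_induction (P := fun f => ∃ B, E.HasDiagIntegral f B) ?_ ?_ ?_ hf hC
  · exact fun c A hA => ⟨_, E.hasDiagIntegral_indicator c hA⟩
  · rintro f g hf hg ⟨_, bf⟩ ⟨_, bg⟩ ⟨B, hB⟩ ⟨D, hD⟩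
    exact ⟨_, hB.add hD hf (E.essBounded_of_le bf) hg (E.essBounded_of_le bg)⟩
  · intro f g C hf hg bf bg hlim h
    choose B hB using h
    refine exists_inner_self_eq_of_tendsto (B := B) (C := C) (l := atTop)
      (fun n => (hB n).norm_inner_self_le (bf n)) fun x => ?_
    simp_rw [hB _ x]
    exact tendsto_integral_diagMeasure hf bf hlim x

theorem EssBounded.exists_hasDiagIntegral (bf : E.EssBounded f) (hf : Measurable f) :
    ∃ B, E.HasDiagIntegral f B := by
  obtain ⟨g, C, hg, hC, hn⟩ := bf.exists_bounded hf
  obtain ⟨B, hB⟩ := E.exists_hasDiagIntegral_of_le hg hC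
  exact ⟨B, hB.congr (by simpa only [eq_comm] using hn)⟩

/-- Properties of integrals that are stable under weak limits hold for bounded functions if they
hold for indicators and are additive. -/
theorem HasDiagIntegral.bounded_induction {P : (Ω → ℂ) → (K →L[ℂ] K) → Prop}
    (indicator : ∀ (c : ℂ) (A : Set Ω), MeasurableSet A → P (A.indicator fun _ => c) (c • E A))
    (add : ∀ (f g : Ω → ℂ) (B D : K →L[ℂ] K), Measurable f → Measurable g →
      E.EssBounded f → E.EssBounded g → P f B → P g D → P (f + g) (B + D))
    (lim : ∀ (f : ℕ → Ω → ℂ) (g : Ω → ℂ) (B : ℕ → K →L[ℂ] K) (D : K →L[ℂ] K) (C : ℝ),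
      (∀ n, Measurable (f n)) → Measurable g → (∀ n z, ‖f n z‖ ≤ C) → (∀ z, ‖g z‖ ≤ C) →
      (∀ z, Tendsto (fun n => f n z) atTop (𝓝 (g z))) →
      (∀ x y, Tendsto (fun n => inner ℂ y (B n x)) atTop (𝓝 (inner ℂ y (D x)))) →
      (∀ n, P (f n) (B n)) → P g D)
    (h : E.HasDiagIntegral f B) (hf : Measurable f) {C : ℝ} (hC : ∀ z, ‖f z‖ ≤ C) : P f B := by
  refine Measurable.bounded_induction (P := fun f => ∀ B, E.HasDiagIntegral f B → P f B)
    ?_ ?_ ?_ hf hC B h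
  · intro c A hA B hB
    rw [hB.unique (E.hasDiagIntegral_indicator c hA)]
    exact indicator c A hA
  · rintro f g hf hg ⟨C, hC⟩ ⟨C', hC'⟩ hB hD B h
    obtain ⟨Bf, hBf⟩ := E.exists_hasDiagIntegral_of_le hf hC
    obtain ⟨Bg, hBg⟩ := E.exists_hasDiagIntegral_of_le hg hC'
    have b := E.essBounded_of_le hC
    have b' := E.essBounded_of_le hC'
    rw [h.unique (hBf.add hBg hf b hg b')]
    exact add f g Bf Bg hf hg b b' (hB _ hBf) (hD _ hBg)
  · intro f g C hf hg bf bg hlim hP D hD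
    choose B hB using fun n => E.exists_hasDiagIntegral_of_le (hf n) (bf n)
    refine lim f g B D C hf hg bf bg hlim (tendsto_inner_of_tendsto_inner_self fun x => ?_)
      fun n => hP n _ (hB n)
    simp_rw [hB _ x, hD x]
    exact tendsto_integral_diagMeasure hf bf hlim x

theorem HasDiagIntegral.commute_proj (h : E.HasDiagIntegral f B) (hf : Measurable f)
    (bf : E.EssBounded f) {A : Set Ω} (hA : MeasurableSet A) : Commute (E A) B := by
  -- The integral splits over A and its complement, and each piece is the form of a compression, so
  -- B is block diagonal with respect to E(A).
  have key : B = E A * B * E A + E Aᶜ * B * E Aᶜ := by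
    refine eq_of_inner_self_eq fun x => ?_
    simp only [add_apply, mul_apply_eq_comp, inner_add_right]
    rw [← E.adjoint_eq hA, ← E.adjoint_eq hA.compl, ContinuousLinearMap.adjoint_inner_right,
      ContinuousLinearMap.adjoint_inner_right, E.adjoint_eq hA, E.adjoint_eq hA.compl, h, h, h,
      E.diagMeasure_proj x hA, E.diagMeasure_proj x hA.compl,
      integral_add_compl hA (bf.integrable hf x)]
  have h1 : E A * E Aᶜ = 0 := by rw [← E.inter' _ _ hA hA.compl, Set.inter_compl_self, E.empty']
  have h2 : E Aᶜ * E A = 0 := by rw [← E.inter' _ _ hA.compl hA, Set.compl_inter_self, E.empty']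
  have h3 : E A * B = E A * B * E A := by
    conv_lhs => rw [key]
    simp only [mul_add, ← mul_assoc, E.mul_self_eq hA, h1, zero_mul, add_zero]
  have h4 : B * E A = E A * B * E A := by
    conv_lhs => rw [key]
    simp only [add_mul, mul_assoc, E.mul_self_eq hA, h2, mul_zero, add_zero]
  exact h3.trans h4.symm

theorem HasDiagIntegral.indicator_mul (h : E.HasDiagIntegral f B) (hf : Measurable f)
    (bf : E.EssBounded f) {A : Set Ω} (hA : MeasurableSet A) :
    E.HasDiagIntegral (A.indicator f) (E A * B) := by
  intro x
  have hc : E A * B = E A * B * E A := by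
    rw [mul_assoc, ← (h.commute_proj hf bf hA).eq, ← mul_assoc, E.mul_self_eq hA]
  rw [hc, mul_apply_eq_comp, mul_apply_eq_comp, ← ContinuousLinearMap.adjoint_inner_left,
    E.adjoint_eq hA, h, E.diagMeasure_proj x hA, integral_indicator hA]

/-- Induction on f with g fixed: the indicator case is `indicator_mul`. Only the left factor varies,
so weak convergence, tested on the fixed vector D x, is enough. -/
theorem HasDiagIntegral.mul_of_le (h : E.HasDiagIntegral f B) (h' : E.HasDiagIntegral g D)
    (hf : Measurable f) {C : ℝ} (hC : ∀ z, ‖f z‖ ≤ C) (hg : Measurable g)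
    (bg : E.EssBounded g) : E.HasDiagIntegral (f * g) (B * D) := by
  refine HasDiagIntegral.bounded_induction (P := fun f B => E.HasDiagIntegral (f * g) (B * D))
    ?_ ?_ ?_ h hf hC
  · intro c A hA
    convert! (h'.indicator_mul hg bg hA).smul c using 1
    ext z
    by_cases hz : z ∈ A <;> simp [hz]
  · intro f₁ f₂ B₁ B₂ hf₁ hf₂ bf₁ bf₂ h₁ h₂
    rw [add_mul, add_mul]
    exact h₁.add h₂ (hf₁.mul hg) (bf₁.mul bg) (hf₂.mul hg) (bf₂.mul bg)
  · intro f f₀ B B₀ C hf hf₀ bf bf₀ hlim hB hP x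
    refine tendsto_nhds_unique (hB (D x) x) ?_
    have hn (n : ℕ) : inner ℂ x (B n (D x)) = ∫ z, (f n * g) z ∂E.diagMeasure x := hP n x
    simp_rw [hn]
    refine tendsto_integral_of_dominated_convergence (fun z => C * ‖g z‖)
      (fun n => ((hf n).mul hg).aestronglyMeasurable) ((bg.integrable hg x).norm.const_mul C)
      (fun n => Eventually.of_forall fun z => ?_)
      (Eventually.of_forall fun z => (hlim z).mul_const _)
    rw [Pi.mul_apply, norm_mul]
    gcongr
    exact bf n z

theorem HasDiagIntegral.mul (h : E.HasDiagIntegral f B) (h' : E.HasDiagIntegral g D)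
    (hf : Measurable f) (bf : E.EssBounded f) (hg : Measurable g)
    (bg : E.EssBounded g) : E.HasDiagIntegral (f * g) (B * D) := by
  obtain ⟨f', C, hf', hC, hn⟩ := bf.exists_bounded hf
  refine ((h.congr hn).mul_of_le h' hf' hC hg bg).congr (hn.mono fun z hz hc => hz ?_)
  rw [Pi.mul_apply, Pi.mul_apply, hc]

theorem HasDiagIntegral.norm_sq (h : E.HasDiagIntegral f B) (hf : Measurable f)
    (bf : E.EssBounded f) (x : K) : ‖B x‖ ^ 2 = ∫ z, ‖f z‖ ^ 2 ∂E.diagMeasure x := by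
  have h1 := h.adjoint.mul h (Complex.continuous_conj.measurable.comp hf) bf.star hf bf x
  rw [mul_apply_eq_comp, ContinuousLinearMap.adjoint_inner_right, inner_self_eq_norm_sq_to_K] at h1
  apply Complex.ofReal_injective
  rw [← integral_complex_ofReal]
  convert! h1 using 1
  · push_cast; rfl
  · refine integral_congr_ae (Eventually.of_forall fun z => ?_)
    simp [Complex.conj_mul']

end Diagonal

/-! ### From diagonal measures to the complex measures ⟨E(·)x, y⟩. -/

section Weak

variable {Ω : Type*} {m : MeasurableSpace Ω}
  {K : Type*} [NormedAddCommGroup K] [InnerProductSpace ℂ K] [CompleteSpace K]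
  {E : SpectralMeasure ℂ m K} {f : Ω → ℂ} {B : K →L[ℂ] K}

-- Since |⟨E(A)x, y⟩| ≤ ‖E(A)x‖‖E(A)y‖, the variation is controlled by positive measures;
-- finiteness, null sets and integrability for complex measures are inherited from the diagonal.
variable (E) in
theorem variation_scalar_le (x y : K) :
    (E.scalar x y).variation ≤ E.diagMeasure x + E.diagMeasure y := by
  refine VectorMeasure.variation_le_of_forall_enorm_le fun A hA => ?_
  rw [Measure.add_apply, E.diagMeasure_apply x hA, E.diagMeasure_apply y hA, scalar_apply,
    ← ENNReal.ofReal_add (by positivity) (by positivity), ← ofReal_norm,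
    E.inner_apply hA]
  refine ENNReal.ofReal_le_ofReal ((norm_inner_le_norm _ _).trans ?_)
  nlinarith [sq_nonneg (‖E A x‖ - ‖E A y‖), sq_nonneg ‖E A x‖, sq_nonneg ‖E A y‖]

instance (x y : K) : IsFiniteMeasure (E.scalar x y).variation :=
  isFiniteMeasure_of_le _ (E.variation_scalar_le x y)

variable (E) in
theorem ae_scalar_of_null {p : Ω → Prop} (h : E.Null {z | ¬ p z}) (x y : K) :
    ∀ᵐ z ∂(E.scalar x y).variation, p z :=
  ae_mono (E.variation_scalar_le x y)
    (ae_add_measure_iff.mpr ⟨E.ae_of_null h x, E.ae_of_null h y⟩)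

theorem EssBounded.integrable_scalar (bf : E.EssBounded f) (hf : Measurable f) (x y : K) :
    (E.scalar x y).Integrable f :=
  ((bf.integrable hf x).add_measure (bf.integrable hf y)).mono_measure (E.variation_scalar_le x y)

/-- Both sides are additive in f and stable under bounded pointwise limits, the left by polarized
weak convergence and the right by dominated convergence, so indicators suffice. -/
theorem HasDiagIntegral.hasIntegral (h : E.HasDiagIntegral f B) (hf : Measurable f)
    (bf : E.EssBounded f) : E.HasIntegral f B := by
  refine fun x y => ⟨bf.integrable_scalar hf x y, ?_⟩
  obtain ⟨f', C, hf', hC, hn⟩ := bf.exists_bounded hf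
  rw [VectorMeasure.integral_congr_ae (E.ae_scalar_of_null hn x y)]
  refine HasDiagIntegral.bounded_induction (P := fun f B => inner ℂ y (B x) =
    ∫ᵛ z, f z ∂[ContinuousLinearMap.mul ℝ ℂ; E.scalar x y]) ?_ ?_ ?_ (h.congr hn) hf' hC
  · intro c A hA
    rw [VectorMeasure.integral_eq_setToFun,
      setToFun_indicator_const _ hA (measure_ne_top _ _), smul_apply, inner_smul_right]
    rfl
  · intro f g B D hf hg bf bg h₁ h₂
    rw [VectorMeasure.integral_add (bf.integrable_scalar hf x y) (bg.integrable_scalar hg x y),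
      ← h₁, ← h₂, add_apply, inner_add_right]
  · intro f g B D C hf hg bf bg hlim hB hP
    refine tendsto_nhds_unique (hB x y) ?_
    simp_rw [hP]
    exact VectorMeasure.tendsto_integral_of_dominated_convergence (fun _ => C)
      (fun n => (hf n).aestronglyMeasurable) (integrable_const C)
      (fun n => Eventually.of_forall (bf n)) (Eventually.of_forall hlim)

theorem HasIntegral.hasDiagIntegral (h : E.HasIntegral f B) (hf : Measurable f)
    (bf : E.EssBounded f) : E.HasDiagIntegral f B := by
  obtain ⟨D, hD⟩ := bf.exists_hasDiagIntegral hf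
  have : B = D := by
    ext1 x
    refine ext_inner_left ℂ fun y => ?_
    rw [(h x y).2, (hD.hasIntegral hf bf x y).2]
  rwa [this]

/-- An operator that commutes with the spectral measure commutes with the integrals. -/
theorem HasDiagIntegral.commute_of_commute (h : E.HasDiagIntegral f B) (hf : Measurable f)
    (bf : E.EssBounded f) {S : K →L[ℂ] K} (hS : ∀ A, MeasurableSet A → Commute S (E A)) :
    Commute S B := by
  have hw := h.hasIntegral hf bf
  have hν (x y : K) : E.scalar (S x) y = E.scalar x (ContinuousLinearMap.adjoint S y) := by
    ext A hA
    rw [scalar_apply, scalar_apply, ContinuousLinearMap.adjoint_inner_left,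
      ← mul_apply_eq_comp, ← mul_apply_eq_comp, (hS A hA).eq]
  change S * B = B * S
  ext1 x
  refine ext_inner_left ℂ fun y => ?_
  rw [mul_apply_eq_comp, mul_apply_eq_comp, (hw _ y).2, hν, ← (hw _ _).2,
    ContinuousLinearMap.adjoint_inner_left]

end Weak

end SpectralMeasure

/-! ### Riesz–Markov measures of a representation of C(X). -/

section Representation

variable {X : Type*} [TopologicalSpace X]
  {K : Type*} [NormedAddCommGroup K] [InnerProductSpace ℂ K] [CompleteSpace K]

/-- A real continuous function as a complex continuous function. -/
def ContinuousMap.complexOfReal (f : C(X, ℝ)) : C(X, ℂ) :=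
  ⟨fun z => (f z : ℂ), Complex.continuous_ofReal.comp f.continuous⟩

theorem inner_self_complexOfReal (φ : C(X, ℂ) →⋆ₐ[ℂ] (K →L[ℂ] K)) (f : C(X, ℝ)) (x : K) :
    (((inner ℂ x (φ f.complexOfReal x)).re : ℝ) : ℂ) = inner ℂ x (φ f.complexOfReal x) := by
  rw [← Complex.conj_eq_iff_re, inner_conj_symm, ← ContinuousLinearMap.adjoint_inner_right,
    ← ContinuousLinearMap.star_eq_adjoint, ← map_star]
  congr 3
  ext z
  simp [ContinuousMap.complexOfReal]

theorem measureReal_univ_of_inner [MeasurableSpace X] {φ : C(X, ℂ) →⋆ₐ[ℂ] (K →L[ℂ] K)}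
    {μ : K → Measure X}
    (hμ : ∀ x, ∀ f : C(X, ℂ), inner ℂ x (φ f x) = ∫ z, f z ∂μ x)
    (x : K) : (μ x).real Set.univ = ‖x‖ ^ 2 := by
  have h := hμ x 1
  rw [map_one, one_apply_eq_self, inner_self_eq_norm_sq_to_K] at h
  apply Complex.ofReal_injective
  simpa using h.symm

theorem exists_measure_inner_self_eq_integral [CompactSpace X] [T2Space X] [MeasurableSpace X] [BorelSpace X]
    (φ : C(X, ℂ) →⋆ₐ[ℂ] (K →L[ℂ] K)) (x : K) :
    ∃ μ : Measure X, IsFiniteMeasure μ ∧ ∀ f : C(X, ℂ), inner ℂ x (φ f x) = ∫ z, f z ∂μ := by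
  let L : CompactlySupportedContinuousMap X ℝ →ₗ[ℝ] ℝ :=
    { toFun := fun f => (inner ℂ x (φ (f : C(X, ℝ)).complexOfReal x)).re
      map_add' := fun f g => by
        rw [← Complex.add_re, ← inner_add_right, ← add_apply, ← map_add]
        congr 5
        ext z
        simp [ContinuousMap.complexOfReal]
      map_smul' := fun c f => by
        rw [RingHom.id_apply, smul_eq_mul, ← Complex.re_ofReal_mul, ← inner_smul_right,
          ← smul_apply, ← map_smul]
        congr 5
        ext z
        simp [ContinuousMap.complexOfReal] }
  have hL (f : CompactlySupportedContinuousMap X ℝ) (hf : 0 ≤ f) : 0 ≤ L f := by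
    -- Positivity: with g = √f the form of φ(f) at x is ‖φ(g)x‖².
    let g : C(X, ℝ) := ⟨fun z => √(f z), f.continuous.sqrt⟩
    have hg : (f : C(X, ℝ)).complexOfReal = star g.complexOfReal * g.complexOfReal := by
      ext z
      have := Real.mul_self_sqrt (show 0 ≤ f z from hf z)
      simp [ContinuousMap.complexOfReal, g, ← Complex.ofReal_mul, this]
    change 0 ≤ (inner ℂ x (φ (f : C(X, ℝ)).complexOfReal x)).re
    rw [hg, map_mul, map_star, ContinuousLinearMap.star_eq_adjoint, mul_apply_eq_comp,
      ContinuousLinearMap.adjoint_inner_right]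
    exact inner_self_nonneg (𝕜 := ℂ)
  let Λ := PositiveLinearMap.mk₀ L hL
  refine ⟨RealRMK.rieszMeasure Λ, inferInstance, fun f => ?_⟩
  have hr (g : C(X, ℝ)) : inner ℂ x (φ g.complexOfReal x) =
      ∫ z, (g.complexOfReal z) ∂ RealRMK.rieszMeasure Λ := by
    rw [← inner_self_complexOfReal]
    have h := RealRMK.integral_rieszMeasure Λ ⟨g, HasCompactSupport.of_compactSpace _⟩
    rw [show (inner ℂ x (φ g.complexOfReal x)).re = _ from h.symm, ← integral_complex_ofReal]
    rfl
  let a : C(X, ℝ) := ⟨fun z => (f z).re, Complex.continuous_re.comp f.continuous⟩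
  let b : C(X, ℝ) := ⟨fun z => (f z).im, Complex.continuous_im.comp f.continuous⟩
  have hf : f = a.complexOfReal + Complex.I • b.complexOfReal := by
    ext z
    simp [ContinuousMap.complexOfReal, a, b, mul_comm Complex.I, Complex.re_add_im]
  have hi (g : C(X, ℂ)) : Integrable g (RealRMK.rieszMeasure Λ) :=
    g.continuous.integrable_of_hasCompactSupport (HasCompactSupport.of_compactSpace _)
  rw [hf, map_add, map_smul, add_apply, smul_apply, inner_add_right, inner_smul_right, hr, hr,
    ← integral_const_mul, ← integral_add (hi _) ((hi _).const_mul _)]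
  rfl

end Representation

theorem hasSum_measureReal_iUnion {Ω : Type*} [MeasurableSpace Ω] {ν : Measure Ω} [IsFiniteMeasure ν] {A : ℕ → Set Ω}
    (hA : ∀ n, MeasurableSet (A n)) (hd : Pairwise (Disjoint on A)) :
    HasSum (fun n => ((ν.real (A n) : ℝ) : ℂ)) ((ν.real (⋃ n, A n) : ℝ) : ℂ) := by
  simpa using hasSum_integral_iUnion (μ := ν) hA hd (integrable_const (1 : ℂ)).integrableOn

theorem SpectralMeasure.ext_of_diagMeasure {Ω : Type*} {m : MeasurableSpace Ω}
    {K : Type*} [NormedAddCommGroup K] [InnerProductSpace ℂ K] [CompleteSpace K]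
    {E F : SpectralMeasure ℂ m K}
    (h : ∀ x, E.diagMeasure x = F.diagMeasure x) : E = F := by
  have hEF : E.toFun = F.toFun := by
    ext1 A
    by_cases hA : MeasurableSet A
    · refine eq_of_inner_self_eq fun x => ?_
      rw [E.inner_self_apply hA, F.inner_self_apply hA, ← E.diagMeasure_real x hA, h,
        F.diagMeasure_real x hA]
    · rw [E.not_measurable' A hA, F.not_measurable' A hA]
  cases E
  cases F
  congr

/-! ### Spectral measures and representations of C(X). -/

section SpectralTheorem

variable {X : Type*} [MetricSpace X]

/-- Continuous functions with values in `[0, 1]` that decrease to the indicator of a closed set. -/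
noncomputable def closedApprox (A : Set X) (n : ℕ) : C(X, ℂ) :=
  ContinuousMap.complexOfReal ⟨fun z => (thickenedIndicator (Nat.one_div_pos_of_nat
    (α := ℝ) (n := n)) A z : ℝ), by fun_prop⟩

theorem norm_closedApprox_le (A : Set X) (n : ℕ) (z : X) : ‖closedApprox A n z‖ ≤ 1 := by
  simp only [closedApprox, ContinuousMap.complexOfReal, ContinuousMap.coe_mk, Complex.norm_real,
    NNReal.norm_eq]
  exact_mod_cast thickenedIndicator_le_one _ A z

theorem tendsto_closedApprox {A : Set X} (hA : IsClosed A) (z : X) :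
    Tendsto (fun n => closedApprox A n z) atTop (𝓝 (A.indicator (fun _ => (1 : ℂ)) z)) := by
  have h := thickenedIndicator_tendsto_indicator_closure
    (fun n => Nat.one_div_pos_of_nat (α := ℝ) (n := n)) tendsto_one_div_add_atTop_nhds_zero_nat A
  rw [hA.closure_eq, tendsto_pi_nhds] at h
  have h2 := (Complex.continuous_ofReal.tendsto _).comp
    ((NNReal.continuous_coe.tendsto _).comp (h z))
  refine (tendsto_congr fun n => rfl).mp (h2.trans (le_of_eq ?_))
  by_cases hz : z ∈ A <;> simp [hz]

variable [MeasurableSpace X] [BorelSpace X]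

theorem MeasureTheory.Measure.ext_of_integral_continuousMap {μ ν : Measure X} [IsFiniteMeasure μ]
    [IsFiniteMeasure ν] (h : ∀ f : C(X, ℂ), ∫ z, f z ∂μ = ∫ z, f z ∂ν) : μ = ν := by
  refine ext_of_forall_integral_eq_of_IsFiniteMeasure fun f => ?_
  have h1 := h (f.toContinuousMap).complexOfReal
  apply Complex.ofReal_injective
  rw [← integral_complex_ofReal, ← integral_complex_ofReal]
  exact h1

theorem tendsto_integral_closedApprox_mul {A : Set X} (hA : IsClosed A) {r : X → ℂ} {μ : Measure X}
    (hr : Integrable r μ) :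
    Tendsto (fun n => ∫ z, closedApprox A n z * r z ∂μ) atTop (𝓝 (∫ z in A, r z ∂μ)) := by
  rw [← integral_indicator hA.measurableSet]
  refine tendsto_integral_of_dominated_convergence (fun z => ‖r z‖)
    (fun n => ((closedApprox A n).continuous.aestronglyMeasurable).mul hr.1) hr.norm
    (fun n => Eventually.of_forall fun z => ?_) (Eventually.of_forall fun z => ?_)
  · rw [norm_mul]
    exact mul_le_of_le_one_left (norm_nonneg _) (norm_closedApprox_le A n z)
  · convert! (tendsto_closedApprox hA z).mul_const (r z) using 2
    by_cases hz : z ∈ A <;> simp [hz]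

/-- A set function on the Borel sets agrees with a complex measure if it does so on closed sets and
respects complements and countable disjoint unions. -/
theorem setFunction_eq_setIntegral {μ : Measure X} {r : X → ℂ} (hr : Integrable r μ)
    {ν : Set X → ℂ} (hcl : ∀ A, IsClosed A → ν A = ∫ z in A, r z ∂μ)
    (hc : ∀ A, MeasurableSet A → ν Aᶜ = ν Set.univ - ν A)
    (hu : ∀ A : ℕ → Set X, (∀ n, MeasurableSet (A n)) → Pairwise (Disjoint on A) →
      HasSum (fun n => ν (A n)) (ν (⋃ n, A n)))
    {A : Set X} (hA : MeasurableSet A) : ν A = ∫ z in A, r z ∂μ := by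
  refine MeasurableSpace.induction_on_inter (C := fun A _ => ν A = ∫ z in A, r z ∂μ)
    (BorelSpace.measurable_eq.trans borel_eq_generateFrom_isClosed) isPiSystem_isClosed
    (hcl ∅ isClosed_empty) (fun A hA => hcl A hA) ?_ ?_ A hA
  · intro A hA ih
    rw [hc A hA, ih, hcl _ isClosed_univ, Measure.restrict_univ, setIntegral_compl hA hr]
  · intro A hd hA ih
    refine (hu A hA hd).unique ?_
    simp_rw [ih]
    exact hasSum_integral_iUnion hA hd hr.integrableOn

variable {K : Type*} [NormedAddCommGroup K] [InnerProductSpace ℂ K] [CompleteSpace K]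

section Construction

variable {φ : C(X, ℂ) →⋆ₐ[ℂ] (K →L[ℂ] K)} {μ : K → Measure X} [∀ x, IsFiniteMeasure (μ x)]

theorem tendsto_inner_closedApprox
    (hμ : ∀ x, ∀ f : C(X, ℂ), inner ℂ x (φ f x) = ∫ z, f z ∂μ x) {A : Set X} (hA : IsClosed A)
    (x : K) : Tendsto (fun n => inner ℂ x (φ (closedApprox A n) x)) atTop
      (𝓝 (((μ x).real A : ℝ) : ℂ)) := by
  simp_rw [hμ]
  simpa using tendsto_integral_closedApprox_mul (μ := μ x) hA (integrable_const (1 : ℂ))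

/-- A π-λ argument: closed sets arise as limits of `closedApprox`, complements from 1 − P, and
disjoint unions as limits of partial sums. The forms stay below the total mass ‖x‖², so the limits
are bounded operators. -/
theorem exists_inner_self_eq_measureReal
    (hμ : ∀ x, ∀ f : C(X, ℂ), inner ℂ x (φ f x) = ∫ z, f z ∂μ x) {A : Set X}
    (hA : MeasurableSet A) :
    ∃ P : K →L[ℂ] K, ∀ x, inner ℂ x (P x) = (((μ x).real A : ℝ) : ℂ) := by
  refine MeasurableSpace.induction_on_inter
    (C := fun A _ => ∃ P : K →L[ℂ] K, ∀ x, inner ℂ x (P x) = (((μ x).real A : ℝ) : ℂ))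
    (BorelSpace.measurable_eq.trans borel_eq_generateFrom_isClosed) isPiSystem_isClosed
    ⟨0, by simp⟩ ?_ ?_ ?_ A hA
  · intro A hA
    refine exists_inner_self_eq_of_tendsto (C := 1) (fun n x => ?_)
      (tendsto_inner_closedApprox hμ hA)
    rw [hμ, ← measureReal_univ_of_inner hμ x]
    exact norm_integral_le_of_norm_le_const (Eventually.of_forall (norm_closedApprox_le A n))
  · rintro A hA ⟨P, hP⟩
    refine ⟨1 - P, fun x => ?_⟩
    rw [sub_apply, inner_sub_right, hP, one_apply_eq_self, inner_self_eq_norm_sq_to_K,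
      measureReal_compl hA, measureReal_univ_of_inner hμ]
    push_cast
    rfl
  · intro A hd hA h
    choose P hP using h
    have hsum (n : ℕ) (x : K) : inner ℂ x ((∑ i ∈ Finset.range n, P i) x) =
        ∑ i ∈ Finset.range n, (((μ x).real (A i) : ℝ) : ℂ) := by
      rw [sum_apply, inner_sum]
      exact Finset.sum_congr rfl fun i _ => hP i x
    refine exists_inner_self_eq_of_tendsto (B := fun n => ∑ i ∈ Finset.range n, P i) (C := 1)
      (l := atTop) (fun n x => ?_) fun x => ?_
    · rw [hsum, ← measureReal_univ_of_inner hμ x, one_mul, ← Complex.ofReal_sum, Complex.norm_real,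
        Real.norm_of_nonneg (Finset.sum_nonneg fun _ _ => measureReal_nonneg),
        ← measureReal_biUnion_finset (fun i _ j _ hij => hd hij) fun i _ => hA i]
      exact measureReal_mono (Set.subset_univ _)
    · simp_rw [hsum]
      exact (hasSum_measureReal_iUnion hA hd).tendsto_sum_nat

/-- Extends a density formula from continuous functions to Borel sets. It serves twice on the way to
P(A ∩ B) = P(A)P(B): with R = φ(g), r = g, and with R = P(B), r the indicator of B. -/
theorem inner_apply_eq_setIntegral
    (hμ : ∀ x, ∀ f : C(X, ℂ), inner ℂ x (φ f x) = ∫ z, f z ∂μ x) {P : Set X → K →L[ℂ] K}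
    (hP : ∀ A, MeasurableSet A → ∀ x, inner ℂ x (P A x) = (((μ x).real A : ℝ) : ℂ))
    {R : K →L[ℂ] K} {r : X → ℂ} (hr : ∀ x, Integrable r (μ x))
    (hR : ∀ (f : C(X, ℂ)) x, inner ℂ x (φ f (R x)) = ∫ z, f z * r z ∂μ x)
    {A : Set X} (hA : MeasurableSet A) (x : K) :
    inner ℂ x (P A (R x)) = ∫ z in A, r z ∂μ x := by
  refine setFunction_eq_setIntegral (ν := fun A => inner ℂ x (P A (R x))) (hr x) ?_ ?_ ?_ hA
  · intro A hA
    refine tendsto_nhds_unique ?_ (tendsto_integral_closedApprox_mul hA (hr x))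
    simp_rw [← hR]
    refine tendsto_inner_of_tendsto_inner_self (fun y => ?_) _ _
    rw [hP A hA.measurableSet]
    exact tendsto_inner_closedApprox hμ hA y
  · intro A hA
    have : P Aᶜ = P Set.univ - P A := by
      refine eq_of_inner_self_eq fun x => ?_
      rw [sub_apply, inner_sub_right, hP _ hA, hP _ hA.compl, hP _ MeasurableSet.univ,
        measureReal_compl hA, Complex.ofReal_sub]
    rw [this, sub_apply, inner_sub_right]
  · intro A hA hd
    refine hasSum_inner_of_hasSum_inner_self (fun y => ?_) (R x) x
    simp_rw [hP _ (MeasurableSet.iUnion hA), hP _ (hA _)]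
    exact hasSum_measureReal_iUnion hA hd

end Construction
/-- Every representation of the continuous functions on a compact metric space is the integration
with respect to a spectral measure. -/
theorem exists_spectralMeasure [CompactSpace X] (φ : C(X, ℂ) →⋆ₐ[ℂ] (K →L[ℂ] K)) :
    ∃ E : SpectralMeasure ℂ ‹MeasurableSpace X› K, ∀ f : C(X, ℂ), E.HasDiagIntegral f (φ f) := by
  choose μ hfin hμ using exists_measure_inner_self_eq_integral φ
  have hex (A : Set X) : ∃ P : K →L[ℂ] K, (MeasurableSet A →
      ∀ x, inner ℂ x (P x) = (((μ x).real A : ℝ) : ℂ)) ∧ (¬ MeasurableSet A → P = 0) := by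
    by_cases hA : MeasurableSet A
    · obtain ⟨P, hP⟩ := exists_inner_self_eq_measureReal hμ hA
      exact ⟨P, fun _ => hP, fun h => absurd hA h⟩
    · exact ⟨0, fun h => absurd h hA, fun _ => rfl⟩
  choose P hP hP0 using hex
  have hsa (A : Set X) (hA : MeasurableSet A) : ContinuousLinearMap.adjoint (P A) = P A := by
    refine eq_of_inner_self_eq fun x => ?_
    rw [ContinuousLinearMap.adjoint_inner_right, ← inner_conj_symm, hP A hA, Complex.conj_ofReal]
  have hi (f : C(X, ℂ)) (x : K) : Integrable f (μ x) :=
    f.continuous.integrable_of_hasCompactSupport (HasCompactSupport.of_compactSpace _)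
  have h1 (g : C(X, ℂ)) (A : Set X) (hA : MeasurableSet A) (x : K) :
      inner ℂ x (P A (φ g x)) = ∫ z in A, g z ∂μ x := by
    refine inner_apply_eq_setIntegral hμ hP (hi g) (fun f x => ?_) hA x
    rw [← mul_apply_eq_comp, ← map_mul, hμ]
    rfl
  -- Taking adjoints in `h1` for `star g` interchanges the two factors; this is the density
  -- hypothesis needed for R = P(A).
  have h2 (g : C(X, ℂ)) (A : Set X) (hA : MeasurableSet A) (x : K) :
      inner ℂ x (φ g (P A x)) = ∫ z in A, g z ∂μ x := by
    rw [← ContinuousLinearMap.adjoint_inner_left, ← ContinuousLinearMap.star_eq_adjoint,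
      ← map_star, ← hsa A hA, ContinuousLinearMap.adjoint_inner_right, ← inner_conj_symm,
      h1 (star g) A hA x, ← integral_conj]
    simp
  have hmul (A B : Set X) (hA : MeasurableSet A) (hB : MeasurableSet B) :
      P (A ∩ B) = P A * P B := by
    refine eq_of_inner_self_eq fun x => ?_
    rw [mul_apply_eq_comp, inner_apply_eq_setIntegral hμ hP (r := B.indicator fun _ => 1)
      (fun x => (integrable_const _).indicator hB) (fun f x => ?_) hA x, hP _ (hA.inter hB),
      integral_indicator hB, Measure.restrict_restrict hB, Set.inter_comm]
    · simp
    · rw [h2 f B hB, ← integral_indicator hB]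
      congr 1
      ext z
      by_cases hz : z ∈ B <;> simp [hz]
  let E : SpectralMeasure ℂ ‹MeasurableSpace X› K :=
    { toFun := P
      not_measurable' := hP0
      isStarProjection' := fun A hA => ⟨by
        change P A * P A = P A
        rw [← hmul A A hA hA, Set.inter_self], hsa A hA⟩
      empty' := eq_of_inner_self_eq fun x => by rw [hP _ MeasurableSet.empty]; simp
      univ' := eq_of_inner_self_eq fun x => by
        rw [hP _ MeasurableSet.univ, measureReal_univ_of_inner hμ, one_apply_eq_self,
          inner_self_eq_norm_sq_to_K]
        push_cast
        rfl
      inter' := hmul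
      hasSum' := fun x y A hA hd => by
        refine hasSum_inner_of_hasSum_inner_self (fun y => ?_) x y
        simp_rw [hP _ (MeasurableSet.iUnion hA), hP _ (hA _)]
        exact hasSum_measureReal_iUnion hA hd }
  refine ⟨E, fun f x => ?_⟩
  have hE : E.diagMeasure x = μ x := by
    ext A hA
    rw [← measureReal_eq_measureReal_iff, E.diagMeasure_real x hA]
    apply Complex.ofReal_injective
    rw [← E.inner_self_apply hA, ← hP A hA]
  rw [hμ, hE]

/-- The representation of the continuous functions given by a spectral measure. -/
theorem SpectralMeasure.exists_starAlgHom [CompactSpace X]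
    (E : SpectralMeasure ℂ ‹MeasurableSpace X› K) :
    ∃ φ : C(X, ℂ) →⋆ₐ[ℂ] (K →L[ℂ] K), Continuous φ ∧
      ∀ f : C(X, ℂ), E.HasDiagIntegral f (φ f) := by
  have hm (f : C(X, ℂ)) : Measurable f := f.continuous.measurable
  have hb (f : C(X, ℂ)) : E.EssBounded f := E.essBounded_of_le f.norm_coe_le_norm
  choose B hB using fun f : C(X, ℂ) => (hb f).exists_hasDiagIntegral (hm f)
  let φ : C(X, ℂ) →⋆ₐ[ℂ] (K →L[ℂ] K) :=
    { toFun := B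
      map_one' := (hB 1).unique E.hasDiagIntegral_one
      map_mul' := fun f g => (hB (f * g)).unique ((hB f).mul (hB g) (hm f) (hb f) (hm g) (hb g))
      map_zero' := (hB 0).unique fun x => by simp
      map_add' := fun f g => (hB (f + g)).unique ((hB f).add (hB g) (hm f) (hb f) (hm g) (hb g))
      commutes' := fun c => by
        refine (hB _).unique ?_
        rw [Algebra.algebraMap_eq_smul_one, Algebra.algebraMap_eq_smul_one]
        exact E.hasDiagIntegral_one.smul c
      map_star' := fun f => (hB (star f)).unique (hB f).adjoint }
  refine ⟨φ, ?_, hB⟩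
  -- A *-homomorphism of C*-algebras is contractive. Continuity is needed for the uniqueness of
  -- `cfcHom`.
  exact AddMonoidHomClass.continuous_of_bound φ 1 fun f => by
    rw [one_mul]
    exact NonUnitalStarAlgHom.norm_apply_le φ f

end SpectralTheorem

/-! ### The spectral theorem for normal operators, and commutants. -/

section Normal

variable {K : Type*} [NormedAddCommGroup K] [InnerProductSpace ℂ K] [CompleteSpace K]
  {N : K →L[ℂ] K}

instance (N : K →L[ℂ] K) : CompactSpace (spectrum ℂ N) :=
  isCompact_iff_compactSpace.mp (spectrum.isCompact N)

/-- The coordinate function of a compact set is essentially bounded. -/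
theorem essBounded_coe {S : Set ℂ} [CompactSpace S]
    (E : SpectralMeasure ℂ (Subtype.instMeasurableSpace : MeasurableSpace S) K) :
    E.EssBounded (fun z => (z : ℂ)) :=
  E.essBounded_of_le (⟨fun z => (z : ℂ), continuous_subtype_val⟩ : C(S, ℂ)).norm_coe_le_norm

theorem IsSpectralMeasureOf.hasDiagIntegral
    {E : SpectralMeasure ℂ (Subtype.instMeasurableSpace : MeasurableSpace (spectrum ℂ N)) K}
    (h : IsSpectralMeasureOf N E) : E.HasDiagIntegral (fun z => (z : ℂ)) N :=
  SpectralMeasure.HasIntegral.hasDiagIntegral h measurable_subtype_coe (essBounded_coe E)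

/-- Integration against E is a continuous *-homomorphism sending the coordinate function to N, and
the continuous functional calculus is the only one. -/
theorem IsSpectralMeasureOf.hasDiagIntegral_cfcHom (hN : IsStarNormal N)
    {E : SpectralMeasure ℂ (Subtype.instMeasurableSpace : MeasurableSpace (spectrum ℂ N)) K}
    (h : IsSpectralMeasureOf N E) (f : C(spectrum ℂ N, ℂ)) :
    E.HasDiagIntegral f (cfcHom hN f) := by
  obtain ⟨φ, hφ, hE⟩ := E.exists_starAlgHom
  rw [cfcHom_eq_of_continuous_of_map_id hN φ hφ ((hE _).unique h.hasDiagIntegral)]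
  exact hE f

/-- **The spectral theorem** for bounded normal operators. -/
theorem existsUnique_isSpectralMeasureOf (hN : IsStarNormal N) :
    ∃! E, IsSpectralMeasureOf N E := by
  obtain ⟨E, hE⟩ := exists_spectralMeasure (cfcHom hN : C(spectrum ℂ N, ℂ) →⋆ₐ[ℂ] (K →L[ℂ] K))
  have hid := hE (ContinuousMap.restrict (spectrum ℂ N) (ContinuousMap.id ℂ))
  rw [cfcHom_id] at hid
  have hE' : IsSpectralMeasureOf N E := hid.hasIntegral measurable_subtype_coe (essBounded_coe E)
  refine ⟨E, hE', fun F hF => ?_⟩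
  -- Any two candidates integrate continuous functions to the same `cfcHom`, and these integrals
  -- determine the finite measures μ_x.
  refine SpectralMeasure.ext_of_diagMeasure fun x =>
    MeasureTheory.Measure.ext_of_integral_continuousMap fun f => ?_
  rw [← hF.hasDiagIntegral_cfcHom hN f x, ← hE'.hasDiagIntegral_cfcHom hN f x]

/-- An operator that commutes with a normal operator commutes with its spectral measure. -/
theorem IsSpectralMeasureOf.commute (hN : IsStarNormal N)
    {E : SpectralMeasure ℂ (Subtype.instMeasurableSpace : MeasurableSpace (spectrum ℂ N)) K}
    (h : IsSpectralMeasureOf N E) {S : K →L[ℂ] K} (hS : Commute S N)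
    {A : Set (spectrum ℂ N)} (hA : MeasurableSet A) : Commute S (E A) := by
  -- Fuglede's theorem: S also commutes with the adjoint of N, hence with the whole continuous
  -- calculus.
  have hφ (f : C(spectrum ℂ N, ℂ)) : cfcHom hN f * S = S * cfcHom hN f :=
    (Commute.cfcHom hN hS.symm (hN.commute_star_right hS).symm f).eq
  refine MeasurableSpace.induction_on_inter (C := fun A _ => Commute S (E A))
    (BorelSpace.measurable_eq.trans borel_eq_generateFrom_isClosed) isPiSystem_isClosed
    (by rw [E.empty']; exact Commute.zero_right S) ?_ ?_ ?_ A hA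
  · intro A hA
    have hlim (x y : K) : Tendsto (fun n => inner ℂ y (cfcHom hN (closedApprox A n) x)) atTop
        (𝓝 (inner ℂ y (E A x))) := by
      refine tendsto_inner_of_tendsto_inner_self (fun x => ?_) x y
      simp_rw [h.hasDiagIntegral_cfcHom hN _ x]
      have h1 := tendsto_integral_closedApprox_mul (μ := E.diagMeasure x) hA
        (integrable_const (1 : ℂ))
      have h2 := E.hasDiagIntegral_indicator 1 hA.measurableSet x
      rw [one_smul, integral_indicator hA.measurableSet] at h2
      rw [h2]
      simpa using h1
    change S * E A = E A * S
    ext1 x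
    refine ext_inner_left ℂ fun y => ?_
    refine tendsto_nhds_unique ?_ (hlim (S x) y)
    simp_rw [← mul_apply_eq_comp, hφ, mul_apply_eq_comp, ← ContinuousLinearMap.adjoint_inner_left S]
    exact hlim x _
  · intro A hA hc
    rw [E.compl hA]
    exact (Commute.one_right S).sub_right hc
  · intro A hd hA hc
    change S * _ = _ * S
    ext1 x
    refine ext_inner_left ℂ fun y => ?_
    have h1 := E.hasSum' x (ContinuousLinearMap.adjoint S y) A hA hd
    simp_rw [ContinuousLinearMap.adjoint_inner_left, ← mul_apply_eq_comp, (hc _).eq] at h1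
    exact h1.unique (E.hasSum' (S x) y A hA hd)

end Normal

/-! ### Extension of real operators and the conjugation C. -/

namespace Cplx

variable {H : Type*} [NormedAddCommGroup H]

@[simp] theorem re_incl (x : H) : (incl x).re = x := rfl

@[simp] theorem im_incl (x : H) : (incl x).im = 0 := rfl

theorem incl_injective : Injective (incl : H → Cplx H) := fun _ _ h => congrArg re h

theorem norm_incl (x : H) : ‖incl x‖ = ‖x‖ := by
  rw [← sq_eq_sq₀ (norm_nonneg _) (norm_nonneg _), norm_sq]
  simp

variable [InnerProductSpace ℝ H]

theorem inner_incl (x y : H) : inner ℂ (incl x) (incl y) = ((inner ℝ x y : ℝ) : ℂ) := by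
  apply Complex.ext <;> simp [inner_def]

theorem incl_re_add_smul_incl_im (ξ : Cplx H) :
    incl ξ.re + Complex.I • incl ξ.im = ξ := by
  ext <;> simp

theorem extend_incl (T : H →L[ℝ] H) (x : H) : extend T (incl x) = incl (T x) := by
  ext <;> simp [extend_apply]

theorem extend_injective : Injective (extend : (H →L[ℝ] H) → _) := fun S T h => by
  ext x
  apply incl_injective
  rw [← extend_incl, ← extend_incl, h]

theorem extend_mul (S T : H →L[ℝ] H) : extend (S * T) = extend S * extend T := by
  ext ξ <;> simp [extend_apply]

theorem extend_add (S T : H →L[ℝ] H) : extend (S + T) = extend S + extend T := by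
  ext ξ <;> simp [extend_apply]

theorem extend_one : extend (1 : H →L[ℝ] H) = 1 := by
  ext ξ <;> simp [extend_apply]

theorem extend_zero : extend (0 : H →L[ℝ] H) = 0 := by
  ext ξ <;> simp [extend_apply]

theorem extend_smul (r : ℝ) (T : H →L[ℝ] H) : extend (r • T) = (r : ℂ) • extend T := by
  ext ξ <;> simp [extend_apply, -Complex.coe_smul]

theorem extend_commute_iff {S T : H →L[ℝ] H} :
    Commute (extend S) (extend T) ↔ Commute S T := by
  rw [commute_iff_eq, commute_iff_eq, ← extend_mul, ← extend_mul, extend_injective.eq_iff]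

theorem norm_extend (T : H →L[ℝ] H) : ‖extend T‖ = ‖T‖ := by
  apply le_antisymm
  · refine ContinuousLinearMap.opNorm_le_bound _ (norm_nonneg _) fun ξ => ?_
    rw [← sq_le_sq₀ (norm_nonneg _) (by positivity), mul_pow, norm_sq, norm_sq ξ, mul_add,
      ← mul_pow, ← mul_pow]
    gcongr <;> exact T.le_opNorm _
  · refine ContinuousLinearMap.opNorm_le_bound _ (norm_nonneg (extend T)) fun x => ?_
    rw [← norm_incl, ← extend_incl, ← norm_incl x]
    exact (extend T).le_opNorm _

theorem adjoint_extend [CompleteSpace H] (T : H →L[ℝ] H) :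
    ContinuousLinearMap.adjoint (extend T) = extend (ContinuousLinearMap.adjoint T) := by
  symm
  rw [ContinuousLinearMap.eq_adjoint_iff]
  intro ξ η
  apply Complex.ext <;>
    simp [inner_def, extend_apply, ContinuousLinearMap.adjoint_inner_left]

theorem isStarNormal_extend [CompleteSpace H] {T : H →L[ℝ] H} (hT : IsStarNormal T) :
    IsStarNormal (extend T) := by
  refine ⟨?_⟩
  rw [ContinuousLinearMap.star_eq_adjoint, adjoint_extend, extend_commute_iff]
  exact hT.star_comm_self

theorem inner_conjC (ξ η : Cplx H) : inner ℂ (conjC ξ) (conjC η) = conj (inner ℂ ξ η) := by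
  apply Complex.ext <;> simp [inner_def, conjC_apply]
  ring

theorem inner_flat (S : Cplx H →L[ℂ] Cplx H) (ξ η : Cplx H) :
    inner ℂ η (flat S ξ) = conj (inner ℂ (conjC η) (S (conjC ξ))) := by
  rw [flat_apply, ← inner_conjC, conjC_conjC]

theorem flat_mul (S R : Cplx H →L[ℂ] Cplx H) : flat (S * R) = flat S * flat R := by
  ext1 ξ
  simp [flat_apply]

theorem flat_one : flat (1 : Cplx H →L[ℂ] Cplx H) = 1 := by
  ext1 ξ
  simp [flat_apply]

theorem flat_zero : flat (0 : Cplx H →L[ℂ] Cplx H) = 0 := by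
  ext1 ξ
  simp [flat_apply]

theorem flat_extend (T : H →L[ℝ] H) : flat (extend T) = extend T := by
  ext ξ <;> simp [flat_apply, extend_apply, conjC_apply]

theorem isStarProjection_flat [CompleteSpace H] {P : Cplx H →L[ℂ] Cplx H}
    (hP : IsStarProjection P) : IsStarProjection (flat P) := by
  refine ⟨?_, ?_⟩
  · rw [IsIdempotentElem, ← flat_mul, hP.isIdempotentElem.eq]
  · rw [ContinuousLinearMap.isSelfAdjoint_iff_isSymmetric]
    intro ξ η
    have h := hP.isSelfAdjoint.isSymmetric (conjC ξ) (conjC η)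
    change inner ℂ (flat P ξ) η = inner ℂ ξ (flat P η)
    rw [← inner_conj_symm, inner_flat, inner_flat, inner_conj_symm]
    exact congrArg conj h

/-- The real part `x ↦ Re (S x)` on `H` of an operator on `H + iH`. -/
noncomputable def rePart (S : Cplx H →L[ℂ] Cplx H) : H →L[ℝ] H where
  toFun x := (S (incl x)).re
  map_add' x y := by
    rw [← re_add, ← map_add]
    congr 2
    ext <;> simp
  map_smul' r x := by
    have : incl (r • x) = (r : ℂ) • incl x := by
      ext <;> simp [-Complex.coe_smul]
    rw [this, map_smul, re_smul]
    simp
  cont := continuous_re.comp (S.continuous.comp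
    (continuous_mk.comp (continuous_id.prodMk continuous_const)))

/-- An operator fixed by `flat` commutes with C and so preserves its fixed vectors, the copy of H:
the imaginary part of S(x) equals its own negative. -/
theorem extend_rePart {S : Cplx H →L[ℂ] Cplx H} (hS : flat S = S) : extend (rePart S) = S := by
  have h (x : H) : extend (rePart S) (incl x) = S (incl x) := by
    have h1 := congrArg im (congrArg (fun R : Cplx H →L[ℂ] Cplx H => R (incl x)) hS)
    have h2 : conjC (incl x) = incl x := by ext <;> simp [conjC_apply]
    simp only [flat_apply, h2, conjC_apply, im_mk] at h1
    rw [extend_incl]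
    ext
    · rfl
    · have h3 : (2 : ℝ) • (S (incl x)).im = 0 := by
        rw [two_smul]
        exact neg_eq_iff_add_eq_zero.mp h1
      exact ((smul_eq_zero.mp h3).resolve_left two_ne_zero).symm
  ext1 ξ
  rw [← incl_re_add_smul_incl_im ξ, map_add, map_add, map_smul, map_smul, h, h]

end Cplx

namespace SpectralMeasure

open Cplx

/-! ### The norm of an integral is the essential supremum. -/

section Norm

variable {Ω : Type*} {m : MeasurableSpace Ω}
  {K : Type*} [NormedAddCommGroup K] [InnerProductSpace ℂ K] [CompleteSpace K]
  {E : SpectralMeasure ℂ m K} {f : Ω → ℂ} {B : K →L[ℂ] K}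

theorem HasDiagIntegral.norm_eq (h : E.HasDiagIntegral f B) (hf : Measurable f)
    (bf : E.EssBounded f) : ‖B‖ = E.essNorm f := by
  have hi (x : K) : Integrable (fun z => ‖f z‖ ^ 2) (E.diagMeasure x) := by
    have := (bf.mul bf).integrable (hf.mul hf) x
    simpa [sq] using this.norm
  apply le_antisymm
  · refine le_csInf bf ?_
    rintro r ⟨hr, hn⟩
    refine ContinuousLinearMap.opNorm_le_bound _ hr.le fun x => ?_
    rw [← sq_le_sq₀ (norm_nonneg _) (by positivity), mul_pow, h.norm_sq hf bf x,
      ← E.diagMeasure_univ x]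
    have hae : ∀ᵐ z ∂E.diagMeasure x, ‖f z‖ ^ 2 ≤ r ^ 2 := by
      filter_upwards [E.ae_of_null (p := fun z => ‖f z‖ < r)
        (hn.mono fun z hz => not_lt.mp hz) x] with z hz
      gcongr
    refine (integral_mono_ae (hi x) (integrable_const _) hae).trans_eq ?_
    rw [integral_const, smul_eq_mul, mul_comm]
  · refine le_of_forall_gt fun r hr => ?_
    have hr0 : 0 < r := (norm_nonneg B).trans_lt hr
    obtain ⟨s, hs, hsr⟩ := exists_between hr
    have hs0 : 0 < s := (norm_nonneg B).trans_lt hs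
    refine lt_of_le_of_lt (csInf_le ⟨0, fun t ht => ht.1.le⟩ ⟨hs0, ?_⟩) hsr
    -- For s > ‖B‖, vectors v in the range of E({|f| ≥ s}) satisfy s‖v‖ ≤ ‖Bv‖ ≤ ‖B‖‖v‖, which
    -- forces v = 0.
    have hA : MeasurableSet {z | s ≤ ‖f z‖} := measurableSet_le measurable_const hf.norm
    rw [E.null_iff hA]
    ext1 ξ
    set A := {z | s ≤ ‖f z‖}
    have h1 := h.norm_sq hf bf (E A ξ)
    rw [E.diagMeasure_proj ξ hA] at h1
    have h2 : s ^ 2 * ‖E A ξ‖ ^ 2 ≤ ‖B (E A ξ)‖ ^ 2 := by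
      rw [h1, ← E.diagMeasure_real ξ hA]
      refine le_trans (le_of_eq ?_) (setIntegral_mono_on (f := fun _ => s ^ 2)
        (integrable_const _) (hi ξ).integrableOn hA fun z hz => ?_)
      · simp [mul_comm]
      · have : s ≤ ‖f z‖ := hz
        gcongr
    have h3 : ‖B (E A ξ)‖ ≤ ‖B‖ * ‖E A ξ‖ := B.le_opNorm _
    rw [← mul_pow, sq_le_sq₀ (by positivity) (by positivity)] at h2
    have h4 : ‖E A ξ‖ = 0 := by
      by_contra hne
      have hpos : 0 < ‖E A ξ‖ := lt_of_le_of_ne (norm_nonneg _) (Ne.symm hne)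
      nlinarith
    simpa using h4

end Norm

/-! ### Conjugating a spectral measure by C and z ↦ z̄. -/

section Conjugation

variable {S : Set ℂ} [ConjSymm S]
  {H : Type*} [NormedAddCommGroup H] [InnerProductSpace ℝ H] [CompleteSpace H]
  (E : SpectralMeasure ℂ (Subtype.instMeasurableSpace : MeasurableSpace S) (Cplx H))

theorem measurableSet_conjPt_preimage {A : Set S} :
    MeasurableSet (conjPt ⁻¹' A) ↔ MeasurableSet A := by
  refine ⟨fun h => ?_, fun h => measurable_conjPt h⟩
  have h1 := measurable_conjPt h
  rwa [← Set.preimage_comp, show conjPt ∘ conjPt = (id : S → S) from funext conjPt_conjPt] at h1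

/-- The spectral measure `A ↦ E(A^c)♭`. -/
noncomputable def conjugate :
    SpectralMeasure ℂ (Subtype.instMeasurableSpace : MeasurableSpace S) (Cplx H) where
  toFun A := flat (E (conjPt ⁻¹' A))
  not_measurable' A hA := by
    rw [E.not_measurable' _ (mt measurableSet_conjPt_preimage.mp hA), flat_zero]
  isStarProjection' A hA := isStarProjection_flat (E.isStarProjection' _ (measurable_conjPt hA))
  empty' := by rw [Set.preimage_empty, E.empty', flat_zero]
  univ' := by rw [Set.preimage_univ, E.univ', flat_one]
  inter' A B hA hB := by
    rw [Set.preimage_inter, E.inter' _ _ (measurable_conjPt hA) (measurable_conjPt hB), flat_mul]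
  hasSum' x y A hA hd := by
    simp_rw [inner_flat, Set.preimage_iUnion]
    exact Complex.hasSum_conj'.mpr (E.hasSum' (conjC x) (conjC y) (fun n => conjPt ⁻¹' A n)
      (fun n => measurable_conjPt (hA n)) fun i j hij => (hd hij).preimage _)

theorem diagMeasure_conjugate (ξ : Cplx H) :
    E.conjugate.diagMeasure ξ = (E.diagMeasure (conjC ξ)).map conjPt := by
  ext A hA
  rw [Measure.map_apply measurable_conjPt hA, diagMeasure_apply _ _ hA,
    diagMeasure_apply _ _ (measurable_conjPt hA)]
  change ENNReal.ofReal (‖conjC (E (conjPt ⁻¹' A) (conjC ξ))‖ ^ 2) = _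
  rw [LinearIsometry.norm_map]

variable {E}

/-- The inner conjugation is the change of variables z ↦ z̄; the outer one appears because C
conjugates inner products. -/
theorem HasDiagIntegral.conjugate {f : S → ℂ} {B : Cplx H →L[ℂ] Cplx H}
    (h : E.HasDiagIntegral f B) (hf : Measurable f) :
    E.conjugate.HasDiagIntegral (fun z => conj (f (conjPt z))) (flat B) := by
  intro ξ
  have hm : Measurable fun z => conj (f (conjPt z)) :=
    Complex.continuous_conj.measurable.comp (hf.comp measurable_conjPt)
  rw [inner_flat, h, diagMeasure_conjugate, integral_map measurable_conjPt.aemeasurable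
    hm.aestronglyMeasurable, ← integral_conj]
  simp only [conjPt_conjPt]

end Conjugation

end SpectralMeasure

open Cplx

/-! ### Reality of the spectral measure and its restriction to H. -/

section RealOperator

variable {H : Type*} [NormedAddCommGroup H] [InnerProductSpace ℝ H] [CompleteSpace H]
  {T : H →L[ℝ] H} {E : SpectralMeasure ℂ
    (Subtype.instMeasurableSpace : MeasurableSpace (spectrum ℂ (Cplx.extend T))) (Cplx H)}

/-- The operator `extend T` is fixed by `flat`, and z by the double conjugation, so the conjugate
measure also represents `extend T`; uniqueness identifies it with E. -/
theorem IsSpectralMeasureOf.conjugate_eq (hN : IsStarNormal T)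
    (h : IsSpectralMeasureOf (extend T) E) : E.conjugate = E := by
  refine (existsUnique_isSpectralMeasureOf (isStarNormal_extend hN)).unique ?_ h
  have h1 := h.hasDiagIntegral.conjugate measurable_subtype_coe
  rw [flat_extend] at h1
  refine SpectralMeasure.HasDiagIntegral.hasIntegral ?_ measurable_subtype_coe (essBounded_coe _)
  convert! h1 using 2
  exact (Complex.conj_conj _).symm

theorem IsSpectralMeasureOf.flat_eq (hN : IsStarNormal T)
    (h : IsSpectralMeasureOf (extend T) E) (A : Set (spectrum ℂ (extend T))) :
    flat (E A) = E (conjSet A) := by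
  have h1 : flat (E (conjPt ⁻¹' (conjPt ⁻¹' A))) = E (conjPt ⁻¹' A) :=
    congrArg (fun F => F.toFun (conjPt ⁻¹' A)) (h.conjugate_eq hN)
  rwa [← Set.preimage_comp, show conjPt ∘ conjPt = (id : spectrum ℂ (extend T) → _) from
    funext conjPt_conjPt, Set.preimage_id, ← conjSet_eq_preimage] at h1

theorem IsSpectralMeasureOf.flat_eq_self (hN : IsStarNormal T)
    (h : IsSpectralMeasureOf (extend T) E) {A : Set (spectrum ℂ (extend T))}
    (hA : MeasurableSet[E.symmBorel] A) : flat (E A) = E A := by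
  rw [h.flat_eq hN, ← (E.measurableSet_symmBorel.mp hA).2]

/-- The integral of a stem function is the extension of a real operator. -/
theorem IsSpectralMeasureOf.exists_extend_hasDiagIntegral (hN : IsStarNormal T)
    (h : IsSpectralMeasureOf (extend T) E) (f : E.stemFun) :
    ∃ R : H →L[ℝ] H, E.HasDiagIntegral (f : _ → ℂ) (extend R) := by
  obtain ⟨hf, bf, sf⟩ := f.2
  obtain ⟨B, hB⟩ := SpectralMeasure.EssBounded.exists_hasDiagIntegral bf hf
  have h1 := hB.conjugate hf
  rw [h.conjugate_eq hN] at h1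
  -- The operator B♭ integrates conj f(z̄), which the stem condition identifies with f off a null
  -- set.
  have h2 : flat B = B := (h1.congr (g := f) (sf.mono fun z hz hc => hz (by
    rw [hc, Complex.conj_conj]))).unique hB
  exact ⟨rePart B, by rwa [extend_rePart h2]⟩

/-- The map `A ↦ E(A)|_H` on the conjugation invariant sets. -/
noncomputable def SpectralMeasure.restrictReal (E : SpectralMeasure ℂ
    (Subtype.instMeasurableSpace : MeasurableSpace (spectrum ℂ (Cplx.extend T))) (Cplx H)) :
    Set (spectrum ℂ (Cplx.extend T)) → H →L[ℝ] H :=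
  Set.indicator {A | MeasurableSet[E.symmBorel] A} fun A => rePart (E A)

theorem SpectralMeasure.extend_restrictReal {A : Set (spectrum ℂ (Cplx.extend T))} (h : flat (E A) = E A)
    (hA : MeasurableSet[E.symmBorel] A) : Cplx.extend (SpectralMeasure.restrictReal E A) = E A := by
  rw [SpectralMeasure.restrictReal, Set.indicator_of_mem (by exact hA), extend_rePart h]

/-- The restriction of the spectral measure to the conjugation invariant sets and to `H`. -/
noncomputable def IsSpectralMeasureOf.real (hN : IsStarNormal T)
    (h : IsSpectralMeasureOf (extend T) E) : SpectralMeasure ℝ E.symmBorel H :=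
  -- The identities hold for E on the complexification and descend to H because `extend` is
  -- injective.
  have hex {A : Set (spectrum ℂ (extend T))} (hA : MeasurableSet[E.symmBorel] A) :
      Cplx.extend (SpectralMeasure.restrictReal E A) = E A := by
    exact SpectralMeasure.extend_restrictReal (h.flat_eq_self hN hA) hA
  have hb {A : Set (spectrum ℂ (extend T))} (hA : MeasurableSet[E.symmBorel] A) :
      MeasurableSet A := (E.measurableSet_symmBorel.mp hA).1
  { toFun := SpectralMeasure.restrictReal E
    not_measurable' := fun A hA => Set.indicator_of_notMem (s := {A | MeasurableSet[E.symmBorel] A}) hA _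
    isStarProjection' := fun A hA => by
      refine ⟨extend_injective ?_, extend_injective ?_⟩
      · rw [Cplx.extend_mul, hex hA, E.mul_self_eq (hb hA)]
      · rw [ContinuousLinearMap.star_eq_adjoint, ← adjoint_extend, hex hA, E.adjoint_eq (hb hA)]
    empty' := extend_injective (by
      rw [hex (@MeasurableSet.empty _ E.symmBorel), E.empty', Cplx.extend_zero])
    univ' := extend_injective (by
      rw [hex (@MeasurableSet.univ _ E.symmBorel), E.univ', Cplx.extend_one])
    inter' := fun A B hA hB => extend_injective (by
      rw [Cplx.extend_mul, hex hA, hex hB, hex (@MeasurableSet.inter _ E.symmBorel _ _ hA hB),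
        E.inter' _ _ (hb hA) (hb hB)])
    hasSum' := fun x y A hA hd => by
      have h1 := Complex.hasSum_re (E.hasSum' (incl x) (incl y) A (fun n => hb (hA n)) hd)
      have h2 {B : Set (spectrum ℂ (extend T))} (hB : MeasurableSet[E.symmBorel] B) :
          (inner ℂ (incl y) (E B (incl x))).re =
            inner ℝ y ((SpectralMeasure.restrictReal E B) x) := by
        rw [← hex hB, extend_incl, inner_incl, Complex.ofReal_re]
      simp_rw [h2 (hA _), h2 (@MeasurableSet.iUnion _ _ E.symmBorel _ _ hA)] at h1
      exact h1 }

theorem IsSpectralMeasureOf.extend_real (hN : IsStarNormal T)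
    (h : IsSpectralMeasureOf (extend T) E) {A : Set (spectrum ℂ (extend T))}
    (hA : MeasurableSet[E.symmBorel] A) : Cplx.extend (h.real hN A) = E A := by
  exact SpectralMeasure.extend_restrictReal (h.flat_eq_self hN hA) hA

end RealOperator

/-! ### Right ℍ-linearity as a commutation property. -/

section RightLinear

variable {H : Type*} [NormedAddCommGroup H] [InnerProductSpace ℝ H] [CompleteSpace H]
  [Module ℍ H] [Module ℍᵐᵒᵖ H] [HilbertHSpace H]

theorem norm_op_smul (q : ℍ) (x : H) : ‖MulOpposite.op q • x‖ = ‖q‖ * ‖x‖ := by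
  rw [← sq_eq_sq₀ (norm_nonneg _) (by positivity), ← real_inner_self_eq_norm_sq,
    HilbertHSpace.inner_right_mul, ← mul_smul, ← MulOpposite.op_mul, Quaternion.self_mul_star,
    HilbertHSpace.coe_right_mul, real_inner_smul_right, real_inner_self_eq_norm_sq,
    Quaternion.normSq_eq_norm_mul_self]
  ring

/-- The right multiplication by a quaternion as a bounded real operator. -/
noncomputable def rightMul (q : ℍ) : H →L[ℝ] H :=
  LinearMap.mkContinuous
    { toFun := fun x => MulOpposite.op q • x
      map_add' := fun x y => smul_add _ x y
      map_smul' := fun r x => by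
        rw [RingHom.id_apply, ← HilbertHSpace.coe_right_mul, ← HilbertHSpace.coe_right_mul,
          ← mul_smul, ← mul_smul, ← MulOpposite.op_mul, ← MulOpposite.op_mul,
          Quaternion.coe_commutes] } ‖q‖ fun x => (norm_op_smul q x).le

/-- Right linearity becomes membership in a commutant, so it passes from T to its projections and
integrals by the same argument as (v). -/
theorem mem_rightLinear_iff {R : H →L[ℝ] H} :
    R ∈ rightLinear H ↔ ∀ q, Commute (rightMul q) R :=
  ⟨fun h q => ContinuousLinearMap.ext fun x => (h q x).symm,
    fun h q x => (congrArg (fun S : H →L[ℝ] H => S x) (h q)).symm⟩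

theorem isRightLinearC_iff {S : Cplx H →L[ℂ] Cplx H} :
    IsRightLinearC S ↔ ∀ q, Commute (Cplx.extend (rightMul q)) S :=
  ⟨fun h q => ContinuousLinearMap.ext fun ξ => (h q ξ).symm,
    fun h q ξ => (congrArg (fun R : Cplx H →L[ℂ] Cplx H => R ξ) (h q)).symm⟩

end RightLinear

/-! ### The calculus on stem functions and the spectra of restrictions. -/

section Calculus

variable {H : Type*} [NormedAddCommGroup H] [InnerProductSpace ℝ H] [CompleteSpace H]
  {T : H →L[ℝ] H} {E : SpectralMeasure ℂ
    (Subtype.instMeasurableSpace : MeasurableSpace (spectrum ℂ (Cplx.extend T))) (Cplx H)}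

/-- The real operator `∫ f dE` for a stem function `f`. -/
noncomputable def IsSpectralMeasureOf.op (hN : IsStarNormal T)
    (h : IsSpectralMeasureOf (Cplx.extend T) E) (f : E.stemFun) : H →L[ℝ] H :=
  (h.exists_extend_hasDiagIntegral hN f).choose

theorem IsSpectralMeasureOf.hasDiagIntegral_op (hN : IsStarNormal T)
    (h : IsSpectralMeasureOf (Cplx.extend T) E) (f : E.stemFun) :
    E.HasDiagIntegral (f : _ → ℂ) (Cplx.extend (h.op hN f)) :=
  (h.exists_extend_hasDiagIntegral hN f).choose_spec

/-- The algebraic laws of the calculus are checked through this uniqueness, by exhibiting the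
expected operator as an integral. -/
theorem IsSpectralMeasureOf.op_eq (hN : IsStarNormal T)
    (h : IsSpectralMeasureOf (Cplx.extend T) E) {f : E.stemFun} {R : H →L[ℝ] H}
    (hR : E.HasDiagIntegral (f : _ → ℂ) (Cplx.extend R)) : h.op hN f = R :=
  extend_injective ((h.hasDiagIntegral_op hN f).unique hR)

/-- The functional calculus `f ↦ ∫ f dE` on the stem functions. -/
noncomputable def IsSpectralMeasureOf.opHom (hN : IsStarNormal T)
    (h : IsSpectralMeasureOf (Cplx.extend T) E) : E.stemFun →ₐ[ℝ] (H →L[ℝ] H) where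
  toFun := h.op hN
  map_one' := h.op_eq hN (by rw [Cplx.extend_one]; exact E.hasDiagIntegral_one)
  map_mul' f g := h.op_eq hN (by
    rw [Cplx.extend_mul]
    exact (h.hasDiagIntegral_op hN f).mul (h.hasDiagIntegral_op hN g) f.2.1 f.2.2.1 g.2.1 g.2.2.1)
  map_zero' := h.op_eq hN (by rw [Cplx.extend_zero]; intro x; simp)
  map_add' f g := h.op_eq hN (by
    rw [Cplx.extend_add]
    exact (h.hasDiagIntegral_op hN f).add (h.hasDiagIntegral_op hN g) f.2.1 f.2.2.1 g.2.1 g.2.2.1)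
  commutes' r := h.op_eq hN (by
    rw [Algebra.algebraMap_eq_smul_one, Algebra.algebraMap_eq_smul_one, Cplx.extend_smul,
      Cplx.extend_one]
    exact E.hasDiagIntegral_one.smul (r : ℂ))

theorem IsSpectralMeasureOf.norm_op (hN : IsStarNormal T)
    (h : IsSpectralMeasureOf (Cplx.extend T) E) (f : E.stemFun) : ‖h.op hN f‖ = E.essNorm f := by
  rw [← norm_extend]
  exact (h.hasDiagIntegral_op hN f).norm_eq f.2.1 f.2.2.1

theorem IsSpectralMeasureOf.op_star (hN : IsStarNormal T)
    (h : IsSpectralMeasureOf (Cplx.extend T) E) (f : E.stemFun) :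
    h.op hN (star f) = ContinuousLinearMap.adjoint (h.op hN f) :=
  h.op_eq hN (by
    rw [← adjoint_extend]
    exact (h.hasDiagIntegral_op hN f).adjoint)

theorem IsSpectralMeasureOf.commute_op (hN : IsStarNormal T)
    (h : IsSpectralMeasureOf (Cplx.extend T) E) (f : E.stemFun) {S : H →L[ℝ] H}
    (hS : Commute S T) : Commute S (h.op hN f) :=
  extend_commute_iff.mp ((h.hasDiagIntegral_op hN f).commute_of_commute f.2.1 f.2.2.1
    fun _ hA => h.commute (isStarNormal_extend hN) (extend_commute_iff.mpr hS) hA)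

theorem IsSpectralMeasureOf.commute_real (hN : IsStarNormal T)
    (h : IsSpectralMeasureOf (Cplx.extend T) E) {A : Set (spectrum ℂ (Cplx.extend T))}
    (hA : MeasurableSet[E.symmBorel] A) {S : H →L[ℝ] H}
    (hS : Commute S T) : Commute S (h.real hN A) := by
  rw [← extend_commute_iff, h.extend_real hN hA]
  exact h.commute (isStarNormal_extend hN) (extend_commute_iff.mpr hS) hA.1

/-- The coordinate function as a stem function. -/
def stemCoe (E : SpectralMeasure ℂ
    (Subtype.instMeasurableSpace : MeasurableSpace (spectrum ℂ (Cplx.extend T))) (Cplx H)) :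
    E.stemFun :=
  ⟨fun z => (z : ℂ), measurable_subtype_coe, essBounded_coe E,
    E.null_empty.mono fun _ hz => hz rfl⟩

theorem coe_aeval_stemCoe (p : Polynomial ℝ) :
    ((Polynomial.aeval (stemCoe E) p : E.stemFun) : spectrum ℂ (Cplx.extend T) → ℂ) =
      fun z : spectrum ℂ (Cplx.extend T) => Polynomial.aeval (z : ℂ) p := by
  ext z
  have h := Polynomial.aeval_algHom_apply
    ((Pi.evalAlgHom ℝ (fun _ : spectrum ℂ (Cplx.extend T) => ℂ) z).comp
      E.stemFun.toSubalgebra.val) (stemCoe E) p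
  exact h.symm

theorem IsSpectralMeasureOf.op_stemCoe (hN : IsStarNormal T)
    (h : IsSpectralMeasureOf (Cplx.extend T) E) : h.op hN (stemCoe E) = T :=
  h.op_eq hN h.hasDiagIntegral

theorem IsSpectralMeasureOf.op_aeval (hN : IsStarNormal T)
    (h : IsSpectralMeasureOf (Cplx.extend T) E) (p : Polynomial ℝ) :
    h.op hN (Polynomial.aeval (stemCoe E) p) = Polynomial.aeval T p := by
  have h1 := Polynomial.aeval_algHom_apply (h.opHom hN) (stemCoe E) p
  rw [show h.opHom hN (stemCoe E) = T from h.op_stemCoe hN] at h1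
  exact h1.symm

/-- The values of the spectral measure on `A` and on its conjugation invariant part agree. -/
theorem SpectralMeasure.apply_inter_conjPt {A : Set (spectrum ℂ (Cplx.extend T))}
    (hA : MeasurableSet[E.symmBorel] A) : E (A ∩ conjPt ⁻¹' A) = E A := by
  obtain ⟨h1, h2⟩ := E.measurableSet_symmBorel.mp hA
  rw [conjSet_eq_preimage] at h2
  rw [E.inter' _ _ h1 (measurable_conjPt h1), ← h2, E.mul_self_eq h1]

/-- The expression factors as (w − z)(w − z̄), and |w − z̄| = |w̄ − z|; hence both w and w̄ must
keep their distance from z. -/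
theorem norm_sub_mul_sub_conj_ge {z w : ℂ} {d : ℝ} (hd : 0 ≤ d) (h1 : d ≤ ‖w - z‖)
    (h2 : d ≤ ‖conj w - z‖) : d ^ 2 ≤ ‖(z.re - w) ^ 2 + (z.im : ℂ) ^ 2‖ := by
  have h3 : ‖w - conj z‖ = ‖conj w - z‖ := by
    rw [← RCLike.norm_conj]
    simp
  have h4 : (z.re - w) ^ 2 + (z.im : ℂ) ^ 2 = (w - z) * (w - conj z) := by
    have hz : z = z.re + z.im * Complex.I := (Complex.re_add_im z).symm
    have hz' : conj z = z.re - z.im * Complex.I := by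
      apply Complex.ext <;> simp
    rw [hz', show w - z = w - (z.re + z.im * Complex.I) by rw [← hz]]
    linear_combination (z.im : ℂ) ^ 2 * Complex.I_sq
  rw [h4, norm_mul, sq, h3]
  gcongr

theorem IsSpectralMeasureOf.exists_inverse (hN : IsStarNormal T)
    (h : IsSpectralMeasureOf (Cplx.extend T) E) {A : Set (spectrum ℂ (Cplx.extend T))}
    (hA : MeasurableSet[E.symmBorel] A) {z : ℂ} (hz : z ∉ closure (Subtype.val '' A)) :
    ∃ G : H →L[ℝ] H, Commute G T ∧
      G * ((z.re • (1 : H →L[ℝ] H) - T) ^ 2 + (z.im ^ 2) • (1 : H →L[ℝ] H)) = h.real hN A := by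
  obtain ⟨d, hd, hdA⟩ : ∃ d > 0, ∀ w ∈ A, d ≤ ‖(w : ℂ) - z‖ := by
    rw [Metric.mem_closure_iff] at hz
    push Not at hz
    obtain ⟨d, hd, hA⟩ := hz
    refine ⟨d, hd, fun w hw => ?_⟩
    rw [← dist_eq_norm, dist_comm]
    exact hA _ ⟨w, hw, rfl⟩
  -- The set A is conjugation invariant only up to a null set. On D both w and w̄ lie in A, so q is
  -- bounded away from 0, and E(D) = E(A).
  let D : Set (spectrum ℂ (Cplx.extend T)) := A ∩ conjPt ⁻¹' A
  have hD : MeasurableSet D := hA.1.inter (measurable_conjPt hA.1)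
  have hDc (w) : conjPt w ∈ D ↔ w ∈ D := by
    simp only [D, Set.mem_inter_iff, Set.mem_preimage, conjPt_conjPt, and_comm]
  let q : spectrum ℂ (Cplx.extend T) → ℂ := fun w => (z.re - w) ^ 2 + (z.im : ℂ) ^ 2
  have hq (w) (hw : w ∈ D) : d ^ 2 ≤ ‖q w‖ :=
    norm_sub_mul_sub_conj_ge hd.le (hdA w hw.1) (hdA _ hw.2)
  have hqm : Measurable q := by
    have : Measurable fun w : spectrum ℂ (Cplx.extend T) => (w : ℂ) := measurable_subtype_coe
    fun_prop
  -- The cut-off 1/q is a stem function since q has real coefficients and D is conjugation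
  -- invariant; g·q is the indicator of D.
  let g : E.stemFun := ⟨D.indicator fun w => (q w)⁻¹, hqm.inv.indicator hD,
    E.essBounded_of_le (C := (d ^ 2)⁻¹) fun w => by
      by_cases hw : w ∈ D
      · rw [Set.indicator_of_mem hw, norm_inv]
        have := hq w hw
        gcongr
      · rw [Set.indicator_of_notMem hw, norm_zero]
        positivity,
    E.null_empty.mono fun w hw => hw (by
      by_cases hwD : w ∈ D
      · rw [Set.indicator_of_mem hwD, Set.indicator_of_mem ((hDc w).mpr hwD)]
        simp [q, conjPt]
      · rw [Set.indicator_of_notMem hwD, Set.indicator_of_notMem (mt (hDc w).mp hwD), map_zero])⟩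
  let p : Polynomial ℝ := (Polynomial.C z.re - Polynomial.X) ^ 2 + Polynomial.C (z.im ^ 2)
  have hp : Polynomial.aeval T p =
      (z.re • (1 : H →L[ℝ] H) - T) ^ 2 + (z.im ^ 2) • (1 : H →L[ℝ] H) := by
    simp [p, Algebra.algebraMap_eq_smul_one, smul_pow]
  refine ⟨h.op hN g, (h.commute_op hN g (Commute.refl T)).symm, ?_⟩
  rw [← hp, ← h.op_aeval hN p]
  refine (map_mul (h.opHom hN) g (Polynomial.aeval (stemCoe E) p)).symm.trans
    (h.op_eq hN ?_)
  rw [h.extend_real hN hA, ← E.apply_inter_conjPt hA]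
  have h1 := E.hasDiagIntegral_indicator 1 hD
  rw [one_smul] at h1
  convert! h1 using 1
  ext w
  change D.indicator (fun w => (q w)⁻¹) w *
    ((Polynomial.aeval (stemCoe E) p : E.stemFun) : _ → ℂ) w = _
  rw [coe_aeval_stemCoe]
  by_cases hw : w ∈ D
  · have hq0 : q w ≠ 0 := norm_pos_iff.mp ((by positivity : 0 < d ^ 2).trans_le (hq w hw))
    rw [Set.indicator_of_mem hw, Set.indicator_of_mem hw]
    convert! inv_mul_cancel₀ hq0 using 2
    simp [p, q]
  · rw [Set.indicator_of_notMem hw, Set.indicator_of_notMem hw, zero_mul]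

/-- The operator G of `exists_inverse` commutes with T, hence preserves the range of E_ℝ(A). There
E_ℝ(A) is the identity, so the restriction of G is a genuine inverse. -/
theorem IsSpectralMeasureOf.complexSpectrum_restrict_subset (hN : IsStarNormal T)
    (h : IsSpectralMeasureOf (Cplx.extend T) E) {A : Set (spectrum ℂ (Cplx.extend T))}
    (hA : MeasurableSet[E.symmBorel] A) :
    ∃ hT : Set.MapsTo T (h.real hN A).range (h.real hN A).range,
      complexSpectrum (T.restrict hT) ⊆ closure (Subtype.val '' A) := by
  have hmaps {S : H →L[ℝ] H} (hS : Commute S T) :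
      Set.MapsTo S (h.real hN A).range (h.real hN A).range := by
    rintro _ ⟨x, rfl⟩
    exact ⟨S x, congrArg (fun R : H →L[ℝ] H => R x) (h.commute_real hN hA hS).symm⟩
  have hid (x : (h.real hN A).range) : h.real hN A x = x := by
    obtain ⟨_, x, rfl⟩ := x
    exact congrArg (fun R : H →L[ℝ] H => R x) ((h.real hN).isStarProjection' A hA).isIdempotentElem
  refine ⟨hmaps (Commute.refl T), fun z hz => ?_⟩
  by_contra hzA
  obtain ⟨G, hGT, hG⟩ := h.exists_inverse hN hA hzA
  have hG' : ((z.re • (1 : H →L[ℝ] H) - T) ^ 2 + (z.im ^ 2) • (1 : H →L[ℝ] H)) * G =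
      h.real hN A := by
    rw [← hG]
    refine (Commute.add_right (Commute.pow_right (Commute.sub_right ?_ hGT) 2) ?_).eq.symm
    · exact (Commute.one_right G).smul_right _
    · exact (Commute.one_right G).smul_right _
  refine hz ⟨⟨_, G.restrict (hmaps hGT), ?_, ?_⟩, rfl⟩
  · ext x
    exact (congrArg (fun R : H →L[ℝ] H => R x) hG').trans (hid x)
  · ext x
    exact (congrArg (fun R : H →L[ℝ] H => R x) hG).trans (hid x)

end Calculus

/-! ### The main theorem. -/

theorem theorem3p3 {H : Type*} [NormedAddCommGroup H] [InnerProductSpace ℝ H] [CompleteSpace H]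
    [Module ℍ H] [Module ℍᵐᵒᵖ H] [HilbertHSpace H]
    (T : H →L[ℝ] H) (hT : T ∈ rightLinear H) (hN : IsStarNormal T) :
    -- the spectral measure of the complex extension of `T` exists and is unique
    (∃! E, IsSpectralMeasureOf (Cplx.extend T) E) ∧
    ∀ E, IsSpectralMeasureOf (Cplx.extend T) E →
      -- its values are right linear
      (∀ A, IsRightLinearC (E A)) ∧
      -- the sets `A` with `E(A) = E(A^c)`, `A^c = {z̄ : z ∈ A}`, are those for which `E(A)♭ = E(A)`
      (∀ A, MeasurableSet A → (E A = E (conjSet A) ↔ Cplx.flat (E A) = E A)) ∧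
      -- the restriction of `E` to the `σ`-algebra of these sets and to `H` is a real spectral
      -- measure `E_ℝ` with right linear values
      ∃ ER : SpectralMeasure ℝ E.symmBorel H,
        (∀ A, MeasurableSet[E.symmBorel] A → ∀ x, Cplx.incl (ER A x) = E A (Cplx.incl x)) ∧
        (∀ A, ER A ∈ rightLinear H) ∧
        -- `μ_{x,y} = ⟨E(·)x, y⟩` extends `⟨E_ℝ(·)x, y⟩`
        (∀ A, MeasurableSet[E.symmBorel] A → ∀ x y,
          E.scalar (Cplx.incl x) (Cplx.incl y) A = ((ER.scalar x y A : ℝ) : ℂ)) ∧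
        -- the functional calculus
        ∃ Φ : E.LinfStem →ₐ[ℝ] rightLinear H,
          (∀ (f : E.stemFun) (x y : H),
            (E.scalar (Cplx.incl x) (Cplx.incl y)).Integrable (f : _ → ℂ) ∧
            ((inner ℝ ((Φ (E.cls f) : H →L[ℝ] H) x) y : ℝ) : ℂ) =
              ∫ᵛ z, (f : _ → ℂ) z ∂[ContinuousLinearMap.mul ℝ ℂ;
                E.scalar (Cplx.incl x) (Cplx.incl y)]) ∧
          (∀ f : E.stemFun, ‖(Φ (E.cls f) : H →L[ℝ] H)‖ = E.essNorm f) ∧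
          -- (i)
          (∀ p : Polynomial ℝ,
            ∃ hp : (fun z : spectrum ℂ (Cplx.extend T) => Polynomial.aeval (z : ℂ) p) ∈ E.stemFun,
              (Φ (E.cls ⟨_, hp⟩) : H →L[ℝ] H) = Polynomial.aeval T p) ∧
          -- (ii)
          (∀ f : E.stemFun, IsStarNormal (Φ (E.cls f) : H →L[ℝ] H) ∧
            (Φ (E.cls (star f)) : H →L[ℝ] H) =
              ContinuousLinearMap.adjoint (Φ (E.cls f) : H →L[ℝ] H)) ∧
          -- (iii)
          (∀ (f : E.stemFun) (x : H),
            (E.scalar (Cplx.incl x) (Cplx.incl x)).Integrable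
              (fun z => ((‖(f : _ → ℂ) z‖ ^ 2 : ℝ) : ℂ)) ∧
            ((‖(Φ (E.cls f) : H →L[ℝ] H) x‖ ^ 2 : ℝ) : ℂ) =
              ∫ᵛ z, ((‖(f : _ → ℂ) z‖ ^ 2 : ℝ) : ℂ) ∂[ContinuousLinearMap.mul ℝ ℂ;
                E.scalar (Cplx.incl x) (Cplx.incl x)]) ∧
          -- (iv)
          (∀ A, MeasurableSet[E.symmBorel] A →
            ∃ hA : Set.MapsTo T (ER A).range (ER A).range,
              complexSpectrum (T.restrict hA) ⊆ closure (Subtype.val '' A)) ∧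
          -- (v)
          (∀ S : H →L[ℝ] H, S * T = T * S →
            ∀ A, MeasurableSet[E.symmBorel] A → S * ER A = ER A * S) := by

  refine ⟨existsUnique_isSpectralMeasureOf (isStarNormal_extend hN), fun E h => ?_⟩
  have hT' := mem_rightLinear_iff.mp hT
  have hop (f : E.stemFun) : h.op hN f ∈ rightLinear H :=
    mem_rightLinear_iff.mpr fun q => h.commute_op hN f (hT' q)
  refine ⟨fun A => ?_, fun A hA => ?_, h.real hN, fun A hA x => ?_, fun A => ?_,
    fun A hA x y => ?_, ?_⟩
  · by_cases hA : MeasurableSet A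
    · exact isRightLinearC_iff.mpr fun q =>
        h.commute (isStarNormal_extend hN) (extend_commute_iff.mpr (hT' q)) hA
    · rw [E.not_measurable' A hA]
      exact isRightLinearC_iff.mpr fun q => Commute.zero_right _
  · rw [h.flat_eq hN, eq_comm]
  · rw [← h.extend_real hN hA, extend_incl]
  · by_cases hA : MeasurableSet[E.symmBorel] A
    · exact mem_rightLinear_iff.mpr fun q => h.commute_real hN hA (hT' q)
    · rw [(h.real hN).not_measurable' A hA]
      exact zero_mem _
  · rw [SpectralMeasure.scalar_apply, SpectralMeasure.scalar_apply, ← h.extend_real hN hA,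
      extend_incl, inner_incl]
  -- The norm identity `norm_op` shows that the calculus vanishes on the ideal of null functions, so
  -- it factors through the quotient.
  · let Φ : E.LinfStem →ₐ[ℝ] rightLinear H := Ideal.Quotient.liftₐ E.nullFun
      ((h.opHom hN).codRestrict (rightLinear H) hop) fun f hf => Subtype.ext <| by
        have hf' : E.essNorm f = 0 := hf
        rw [← h.norm_op hN, norm_eq_zero] at hf'
        exact hf'
    have hΦ (f : E.stemFun) : (Φ (E.cls f) : H →L[ℝ] H) = h.op hN f := rfl
    refine ⟨Φ, fun f x y => ?_, fun f => (congrArg _ (hΦ f)).trans (h.norm_op hN f), fun p => ?_,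
      fun f => ⟨?_, h.op_star hN f⟩, fun f x => ?_, fun A hA => ?_, fun S hS A hA => ?_⟩
    · have hw := (h.hasDiagIntegral_op hN f).hasIntegral f.2.1 f.2.2.1 (incl x) (incl y)
      rw [extend_incl, inner_incl, real_inner_comm] at hw
      exact hw
    · have hp := coe_aeval_stemCoe (E := E) p
      refine ⟨hp ▸ (Polynomial.aeval (stemCoe E) p).2, ?_⟩
      rw [hΦ, ← h.op_aeval hN p]
      congr 1
      exact Subtype.ext hp.symm
    · refine ⟨?_⟩
      rw [hΦ, ContinuousLinearMap.star_eq_adjoint, ← h.op_star hN]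
      exact ((Commute.all (star f) f).map (h.opHom hN))
    · have hi := h.hasDiagIntegral_op hN f
      have hm : Measurable fun z : spectrum ℂ (Cplx.extend T) => conj ((f : _ → ℂ) z) :=
        Complex.continuous_conj.measurable.comp f.2.1
      have hb := f.2.2.1
      -- For (iii), |f|² = f̄f integrates to Φ(f)*Φ(f), whose form at x is ‖Φ(f)x‖².
      have hw := (hi.adjoint.mul hi hm hb.star f.2.1 hb).hasIntegral (hm.mul f.2.1)
        (hb.star.mul hb) (incl x) (incl x)
      have hf : (fun z : spectrum ℂ (Cplx.extend T) => conj ((f : _ → ℂ) z)) * (f : _ → ℂ) =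
          fun z => ((‖(f : _ → ℂ) z‖ ^ 2 : ℝ) : ℂ) := by
        ext z
        rw [Pi.mul_apply, Complex.conj_mul']
        push_cast
        rfl
      rw [hf, mul_apply_eq_comp, ContinuousLinearMap.adjoint_inner_right, extend_incl,
        inner_incl, real_inner_self_eq_norm_sq] at hw
      exact hw
    · exact h.complexSpectrum_restrict_subset hN hA
    · exact h.commute_real hN hA hS
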